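/- Let $N\ge 0$, let $I_N=\{1,\dots,N\}$, let $g_{\alpha\beta}\in\mathbb R$ ($\alpha\ne\beta$) with $g_{\alpha\beta}\neq 0$ for $\alpha<\beta$, and let $x_\alpha\in\mathbb C$. Let $A$ be the unital associative $\mathbb C$-algebra with generators $D_1,\dots,D_N$ and defining relations $$g_{\alpha\beta}D_\alpha D_\beta-g_{\beta\alpha}D_\beta D_\alpha=x_\beta D_\alpha-x_\alpha D_\beta\qquad(\alpha<\beta).$$ Assume that $A$ is a *Diffusion algebra*, that is, the ordered monomials $D_N^{k_N}\cdots D_2^{k_2}D_1^{k_1}$, $(k_1,\dots,k_N)\in\mathbb Z_{\ge0}^N$, form a linear basis of $A$. **Notation.** Put $I=\{\alpha: x_\alpha\ne0\}$, $R=\{\alpha:x_\alpha=0\}$, $q_{sr}=g_{sr}/g_{rs}$ for $r<s$; let $:D_\alpha D_\beta:$ be $D_\alpha D_\beta$ if $\alpha<\beta$ and $D_\beta D_\alpha$ if $\beta<\alpha$. For a partition of $R$ into nonempty disjoint blocks $R_1,\dots,R_M$, call $R_a$ an *$S$-block* if $g_{ir}g_{ri}\neq0$ for some $r\in R_a$,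 $i\in I$, and a *$T$-block* otherwise. Let $S$ be the union of the $S$-blocks. A $T$-block is denoted $T_b^\bullet$ if there are $i<j$ in $I$ with no element of $I$ strictly between them such that $i<t<j$ for all elements $t$ of the block; otherwise it is denoted $T_a^\circ$. **Theorem.** There is a partition of $R$ into nonempty disjoint blocks $R_a$ such that * (R1) $:D_{r}D_{s}:\,=0$ in $A$ whenever $r,s$ lie in different blocks; * (R2) $D_rD_s-q_{sr}D_sD_r=0$ in $A$ for $r<s$ in the same block; * each block is connected: for every splitting $R_a=R'\sqcup R''$ into nonempty parts there are $r\in R'$, $s\in R''$ with $g_{rs}g_{sr}\ne0$; and, with $S,T^\circ_a,T^\bullet_b$ defined by this partition, $A$ belongs to one of the following five families. That is, for suitable real parameters, $A$ is also the algebra with the same generators $D_1,\dots,D_N$ and with defining relations (R1), (R2) together with the relations listed. 1. $A_I(I,S,T_a^\circ,T_b^\bullet)$, $|I|\ge3$, with $g,g_s,g_a^\circ,g_b^\pm\neq0$: * $g(D_iD_j-D_jD_i)=x_jD_i-x_iD_j$ for $i,j\in I$; * $g_s(D_sD_i-D_iD_s)=x_iD_s$ for $s\in S$, $i\in I$; *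 $g_a^\circ:D_iD_t:\,=-x_iD_t$ for $t\in T_a^\circ$, $i\in I$; * $g_b^+D_iD_t=-x_iD_t$ for $t\in T_b^\bullet$, $i\in I$, $i<t$; * $g_b^-D_tD_i=x_iD_t$ for $t\in T_b^\bullet$, $i\in I$, $i>t$. 2. $A_{II}(I,T_a^\circ,T_b^\bullet)$, $|I|\ge3$, $S=\emptyset$, with $g_i\ne g_j$ for $i\neq j$ in $I$, and with all coefficients $g_i+g_a^\circ$, $g_i+g_b^+$, $g_b^--g_i$ that occur below nonzero: * $(g_i-g_j)D_iD_j=x_jD_i-x_iD_j$ for $i<j$ in $I$; * $(g_i+g_a^\circ):D_iD_t:\,=-x_iD_t$ for $t\in T_a^\circ$, $i\in I$; * $(g_i+g_b^+)D_iD_t=-x_iD_t$ for $t\in T_b^\bullet$, $i\in I$, $i<t$; * $(g_b^--g_i)D_tD_i=x_iD_t$ for $t\in T_b^\bullet$, $i\in I$, $i>t$. 3. $B(\{\mathbf i,\mathbf j\},S,T_a^\circ,T_b^\bullet)$, $I=\{\mathbf i,\mathbf j\}$ with $\mathbf i<\mathbf j$, where $g\ne0$; $g_s\neq0$ for all $s\in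 S$, and $g_s\ne\Lambda$ if $s<\mathbf i$ or $s>\mathbf j$; $g_a^\circ\notin\{0,\Lambda\}$; $g_b^\pm\ne0$: * $gD_{\mathbf i}D_{\mathbf j}-(g-\Lambda)D_{\mathbf j}D_{\mathbf i}=x_{\mathbf j}D_{\mathbf i}-x_{\mathbf i}D_{\mathbf j}$; * $g_sD_{\mathbf i}D_s-(g_s-\Lambda)D_sD_{\mathbf i}=-x_{\mathbf i}D_s$ and $g_sD_sD_{\mathbf j}-(g_s-\Lambda)D_{\mathbf j}D_s=x_{\mathbf j}D_s$ for $s\in S$; * $g_a^\circ:D_{\mathbf i}D_t:\,=-x_{\mathbf i}D_t$ and $(g_a^\circ-\Lambda):D_{\mathbf j}D_t:\,=-x_{\mathbf j}D_t$ for $t\in T_a^\circ$; * $g_b^+D_{\mathbf i}D_t=-x_{\mathbf i}D_t$ and $g_b^-D_tD_{\mathbf j}=x_{\mathbf j}D_t$ for $t\in T_b^\bullet$. 4. $C(\{\mathbf i\},R_a)$, $I=\{\mathbf i\}$, where $g_r\neq0$ for $r>\mathbf i$ and $g_r\ne\Lambda_a$ for $r\in R_a$, $r<\mathbf i$: * $g_rD_{\mathbf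 i}D_r-(g_r-\Lambda_a)D_rD_{\mathbf i}=-x_{\mathbf i}D_r$ for $r\in R_a$. 5. $D(R)$, $I=\emptyset$: * $D_rD_s-q_{sr}D_sD_r=0$ for $r<s$ in $R$. -/

import Mathlib

namespace DiffusionAlgebra

variable {N : ℕ} {A : Type*} [Ring A] [Algebra ℂ A]

/-- `A` is the unital associative complex algebra with generators `D` and defining relations
`r` (pairs of elements of the free algebra to be identified): the canonical algebra
"free algebra modulo `r`" is isomorphic to `A` by an isomorphism that sends generators to
generators. -/
def IsPresentedBy (D : Fin N → A) (r : FreeAlgebra ℂ (Fin N) → FreeAlgebra ℂ (Fin N) → Prop) :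
    Prop :=
  ∃ e : RingQuot r ≃ₐ[ℂ] A, ∀ α, e (RingQuot.mkAlgHom ℂ r (FreeAlgebra.ι ℂ α)) = D α

/-- The free generator with index `α`. -/
noncomputable abbrev X (α : Fin N) : FreeAlgebra ℂ (Fin N) := FreeAlgebra.ι ℂ α

/-- The quadratic relations
`g_{αβ} D_α D_β - g_{βα} D_β D_α = x_β D_α - x_α D_β` for `α < β`. -/
inductive QuadraticRel (g : Fin N → Fin N → ℝ) (x : Fin N → ℂ) :
    FreeAlgebra ℂ (Fin N) → FreeAlgebra ℂ (Fin N) → Prop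
  | rel (α β : Fin N) (h : α < β) :
      QuadraticRel g x
        ((g α β : ℂ) • (X α * X β) - (g β α : ℂ) • (X β * X α))
        (x β • X α - x α • X β)

/-- The ordered monomial `D_N ^ k_N * ... * D_2 ^ k_2 * D_1 ^ k_1` (indices decreasing). -/
def orderedMonomial (D : Fin N → A) (k : Fin N → ℕ) : A :=
  (List.ofFn fun i : Fin N => D i.rev ^ k i.rev).prod

/-- `A`, with generators `D` and quadratic relations with coefficients `g`, `x`, is a
diffusion algebra: the ordered monomials form a linear basis. -/
structure IsDiffusionAlgebra (D : Fin N → A) (g : Fin N → Fin N → ℝ) (x : Fin N → ℂ) :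
    Prop where
  coeff_ne_zero : ∀ α β, α < β → g α β ≠ 0
  presented : IsPresentedBy D (QuadraticRel g x)
  linearIndependent : LinearIndependent ℂ (orderedMonomial D)
  span_eq_top : Submodule.span ℂ (Set.range (orderedMonomial D)) = ⊤

/-! ### The decomposition of the index set -/

open Classical in
/-- `I`: the indices with `x_α ≠ 0`. -/
noncomputable def indexI (x : Fin N → ℂ) : Finset (Fin N) := {α | x α ≠ 0}

open Classical in
/-- `R`: the indices with `x_α = 0`. -/
noncomputable def indexR (x : Fin N → ℂ) : Finset (Fin N) := {α | x α = 0}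

/-- The normally ordered product `:D_α D_β:`. -/
def normalOrd (D : Fin N → A) (α β : Fin N) : A :=
  if α < β then D α * D β else D β * D α

/-- `q_{sr} = g_{sr} / g_{rs}` (used for `r < s`, where `g_{rs} ≠ 0`). -/
noncomputable def qCoeff (g : Fin N → Fin N → ℝ) (s r : Fin N) : ℝ := g s r / g r s

/-- The subdivision `R = R_1 ∪ R_2 ∪ ...` into nonempty disjoint blocks. -/
structure IsBlockDecomposition (D : Fin N → A) (g : Fin N → Fin N → ℝ) {x : Fin N → ℂ}
    (P : Finpartition (indexR x)) : Prop where
  between : ∀ a ∈ P.parts, ∀ b ∈ P.parts, a ≠ b → ∀ r₁ ∈ a, ∀ r₂ ∈ b,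
    normalOrd D r₁ r₂ = 0
  within : ∀ a ∈ P.parts, ∀ r₁ ∈ a, ∀ r₂ ∈ a, r₁ < r₂ →
    D r₁ * D r₂ - (qCoeff g r₂ r₁ : ℂ) • (D r₂ * D r₁) = 0
  connected : ∀ a ∈ P.parts, ∀ a' a'' : Finset (Fin N), a'.Nonempty → a''.Nonempty →
    Disjoint a' a'' → a' ∪ a'' = a → ∃ r₁ ∈ a', ∃ r₂ ∈ a'', g r₁ r₂ * g r₂ r₁ ≠ 0

/-- The block `a` is one of the `S_a`: some `r ∈ a` and `i ∈ I` have `g_{ir} g_{ri} ≠ 0`. -/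
def IsSBlock (g : Fin N → Fin N → ℝ) (x : Fin N → ℂ) (a : Finset (Fin N)) : Prop :=
  ∃ r ∈ a, ∃ i ∈ indexI x, g i r * g r i ≠ 0

/-- The block `a` lies strictly between two consecutive elements of `I`. -/
def InGap (x : Fin N → ℂ) (a : Finset (Fin N)) : Prop :=
  ∃ i ∈ indexI x, ∃ j ∈ indexI x, i < j ∧ (∀ t ∈ a, i < t ∧ t < j) ∧
    ∀ k ∈ indexI x, ¬ (i < k ∧ k < j)

/-- `S`: the union of the blocks `S_a`. -/
def indexS (g : Fin N → Fin N → ℝ) {x : Fin N → ℂ} (P : Finpartition (indexR x)) :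
    Set (Fin N) :=
  {s | ∃ a ∈ P.parts, s ∈ a ∧ IsSBlock g x a}

/-- The blocks `T_a^∘`. -/
def blocksCirc (g : Fin N → Fin N → ℝ) {x : Fin N → ℂ} (P : Finpartition (indexR x)) :
    Set (Finset (Fin N)) :=
  {a | a ∈ P.parts ∧ ¬ IsSBlock g x a ∧ ¬ InGap x a}

/-- The blocks `T_b^•`. -/
def blocksBullet (g : Fin N → Fin N → ℝ) {x : Fin N → ℂ} (P : Finpartition (indexR x)) :
    Set (Finset (Fin N)) :=
  {b | b ∈ P.parts ∧ ¬ IsSBlock g x b ∧ InGap x b}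

/-! ### The relations of the families

In all families `Rb` is the set of blocks of `R`, `q` gives the coefficients of the relations
inside a block, `Tc` is the set of blocks `T_a^∘` and `Tb` the set of blocks `T_b^•`. -/

/-- The relations among the generators indexed by `R`, common to all families. -/
inductive RelR (q : Fin N → Fin N → ℝ) (Rb : Finset (Finset (Fin N))) :
    FreeAlgebra ℂ (Fin N) → FreeAlgebra ℂ (Fin N) → Prop
  | between (a b : Finset (Fin N)) (ha : a ∈ Rb) (hb : b ∈ Rb) (hab : a ≠ b)
      (r₁ r₂ : Fin N) (h₁ : r₁ ∈ a) (h₂ : r₂ ∈ b) :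
      RelR q Rb (normalOrd X r₁ r₂) 0
  | within (a : Finset (Fin N)) (ha : a ∈ Rb) (r₁ r₂ : Fin N) (h₁ : r₁ ∈ a) (h₂ : r₂ ∈ a)
      (h : r₁ < r₂) :
      RelR q Rb (X r₁ * X r₂ - (q r₂ r₁ : ℂ) • (X r₂ * X r₁)) 0

/-- Relations of type `A_I` involving generators of `I`. -/
inductive RelAI (x : Fin N → ℂ) (I : Finset (Fin N)) (S : Set (Fin N))
    (Tc Tb : Set (Finset (Fin N))) (g : ℝ) (gs : Fin N → ℝ) (gc gp gm : Finset (Fin N) → ℝ) :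
    FreeAlgebra ℂ (Fin N) → FreeAlgebra ℂ (Fin N) → Prop
  | II (i j : Fin N) (hi : i ∈ I) (hj : j ∈ I) :
      RelAI x I S Tc Tb g gs gc gp gm
        ((g : ℂ) • (X i * X j - X j * X i)) (x j • X i - x i • X j)
  | SI (s i : Fin N) (hs : s ∈ S) (hi : i ∈ I) :
      RelAI x I S Tc Tb g gs gc gp gm
        ((gs s : ℂ) • (X s * X i - X i * X s)) (x i • X s)
  | circ (a : Finset (Fin N)) (ha : a ∈ Tc) (t i : Fin N) (ht : t ∈ a) (hi : i ∈ I) :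
      RelAI x I S Tc Tb g gs gc gp gm
        ((gc a : ℂ) • normalOrd X i t) (-(x i • X t))
  | bulletPlus (b : Finset (Fin N)) (hb : b ∈ Tb) (t i : Fin N) (ht : t ∈ b) (hi : i ∈ I)
      (h : i < t) :
      RelAI x I S Tc Tb g gs gc gp gm ((gp b : ℂ) • (X i * X t)) (-(x i • X t))
  | bulletMinus (b : Finset (Fin N)) (hb : b ∈ Tb) (t i : Fin N) (ht : t ∈ b) (hi : i ∈ I)
      (h : t < i) :
      RelAI x I S Tc Tb g gs gc gp gm ((gm b : ℂ) • (X t * X i)) (x i • X t)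

/-- Relations of type `A_II` involving generators of `I`. -/
inductive RelAII (x : Fin N → ℂ) (I : Finset (Fin N)) (Tc Tb : Set (Finset (Fin N)))
    (gI : Fin N → ℝ) (gc gp gm : Finset (Fin N) → ℝ) :
    FreeAlgebra ℂ (Fin N) → FreeAlgebra ℂ (Fin N) → Prop
  | II (i j : Fin N) (hi : i ∈ I) (hj : j ∈ I) (h : i < j) :
      RelAII x I Tc Tb gI gc gp gm
        (((gI i - gI j : ℝ) : ℂ) • (X i * X j)) (x j • X i - x i • X j)
  | circ (a : Finset (Fin N)) (ha : a ∈ Tc) (t i : Fin N) (ht : t ∈ a) (hi : i ∈ I) :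
      RelAII x I Tc Tb gI gc gp gm
        (((gI i + gc a : ℝ) : ℂ) • normalOrd X i t) (-(x i • X t))
  | bulletPlus (b : Finset (Fin N)) (hb : b ∈ Tb) (t i : Fin N) (ht : t ∈ b) (hi : i ∈ I)
      (h : i < t) :
      RelAII x I Tc Tb gI gc gp gm
        (((gI i + gp b : ℝ) : ℂ) • (X i * X t)) (-(x i • X t))
  | bulletMinus (b : Finset (Fin N)) (hb : b ∈ Tb) (t i : Fin N) (ht : t ∈ b) (hi : i ∈ I)
      (h : t < i) :
      RelAII x I Tc Tb gI gc gp gm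
        (((gm b - gI i : ℝ) : ℂ) • (X t * X i)) (x i • X t)

/-- Relations of type `B` involving the two generators of `I = {i, j}`. -/
inductive RelB (x : Fin N → ℂ) (i j : Fin N) (S : Set (Fin N))
    (Tc Tb : Set (Finset (Fin N))) (g Λ : ℝ) (gs : Fin N → ℝ) (gc gp gm : Finset (Fin N) → ℝ) :
    FreeAlgebra ℂ (Fin N) → FreeAlgebra ℂ (Fin N) → Prop
  | ij :
      RelB x i j S Tc Tb g Λ gs gc gp gm
        ((g : ℂ) • (X i * X j) - ((g - Λ : ℝ) : ℂ) • (X j * X i)) (x j • X i - x i • X j)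
  | iS (s : Fin N) (hs : s ∈ S) :
      RelB x i j S Tc Tb g Λ gs gc gp gm
        ((gs s : ℂ) • (X i * X s) - ((gs s - Λ : ℝ) : ℂ) • (X s * X i)) (-(x i • X s))
  | Sj (s : Fin N) (hs : s ∈ S) :
      RelB x i j S Tc Tb g Λ gs gc gp gm
        ((gs s : ℂ) • (X s * X j) - ((gs s - Λ : ℝ) : ℂ) • (X j * X s)) (x j • X s)
  | iCirc (a : Finset (Fin N)) (ha : a ∈ Tc) (t : Fin N) (ht : t ∈ a) :
      RelB x i j S Tc Tb g Λ gs gc gp gm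
        ((gc a : ℂ) • normalOrd X i t) (-(x i • X t))
  | jCirc (a : Finset (Fin N)) (ha : a ∈ Tc) (t : Fin N) (ht : t ∈ a) :
      RelB x i j S Tc Tb g Λ gs gc gp gm
        (((gc a - Λ : ℝ) : ℂ) • normalOrd X j t) (-(x j • X t))
  | iBullet (b : Finset (Fin N)) (hb : b ∈ Tb) (t : Fin N) (ht : t ∈ b) :
      RelB x i j S Tc Tb g Λ gs gc gp gm
        ((gp b : ℂ) • (X i * X t)) (-(x i • X t))
  | bulletj (b : Finset (Fin N)) (hb : b ∈ Tb) (t : Fin N) (ht : t ∈ b) :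
      RelB x i j S Tc Tb g Λ gs gc gp gm
        ((gm b : ℂ) • (X t * X j)) (x j • X t)

/-- Relations of type `C` involving the single generator of `I = {i}`. -/
inductive RelC (x : Fin N → ℂ) (i : Fin N) (Rb : Finset (Finset (Fin N)))
    (gr : Fin N → ℝ) (Λ : Finset (Fin N) → ℝ) :
    FreeAlgebra ℂ (Fin N) → FreeAlgebra ℂ (Fin N) → Prop
  | iR (a : Finset (Fin N)) (ha : a ∈ Rb) (r : Fin N) (hr : r ∈ a) :
      RelC x i Rb gr Λ
        ((gr r : ℂ) • (X i * X r) - ((gr r - Λ a : ℝ) : ℂ) • (X r * X i)) (-(x i • X r))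

/-- Relations of type `D`. -/
inductive RelD (q : Fin N → Fin N → ℝ) (R : Finset (Fin N)) :
    FreeAlgebra ℂ (Fin N) → FreeAlgebra ℂ (Fin N) → Prop
  | RR (r s : Fin N) (hr : r ∈ R) (hs : s ∈ R) (h : r < s) :
      RelD q R (X r * X s - (q s r : ℂ) • (X s * X r)) 0

/-! ### The five families -/

/-- `A`, with generators `D`, belongs to the family `A_I(I, S, T_a^∘, T_b^•)`. -/
def IsTypeAI (D : Fin N → A) (x : Fin N → ℂ) (q : Fin N → Fin N → ℝ)
    (Rb : Finset (Finset (Fin N))) (I : Finset (Fin N)) (S : Set (Fin N))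
    (Tc Tb : Set (Finset (Fin N))) : Prop :=
  3 ≤ I.card ∧
  ∃ (g : ℝ) (gs : Fin N → ℝ) (gc gp gm : Finset (Fin N) → ℝ),
    g ≠ 0 ∧ (∀ s ∈ S, gs s ≠ 0) ∧ (∀ a ∈ Tc, gc a ≠ 0) ∧ (∀ b ∈ Tb, gp b ≠ 0 ∧ gm b ≠ 0) ∧
    IsPresentedBy D fun u v => RelAI x I S Tc Tb g gs gc gp gm u v ∨ RelR q Rb u v

/-- `A`, with generators `D`, belongs to the family `A_II(I, T_a^∘, T_b^•)`. -/
def IsTypeAII (D : Fin N → A) (x : Fin N → ℂ) (q : Fin N → Fin N → ℝ)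
    (Rb : Finset (Finset (Fin N))) (I : Finset (Fin N)) (S : Set (Fin N))
    (Tc Tb : Set (Finset (Fin N))) : Prop :=
  3 ≤ I.card ∧ S = ∅ ∧
  ∃ (gI : Fin N → ℝ) (gc gp gm : Finset (Fin N) → ℝ),
    (∀ i ∈ I, ∀ j ∈ I, i ≠ j → gI i ≠ gI j) ∧
    (∀ a ∈ Tc, ∀ i ∈ I, gI i ≠ -gc a) ∧
    (∀ b ∈ Tb, ∀ t ∈ b, ∀ i ∈ I, (i < t → gI i ≠ -gp b) ∧ (t < i → gI i ≠ gm b)) ∧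
    IsPresentedBy D fun u v => RelAII x I Tc Tb gI gc gp gm u v ∨ RelR q Rb u v

/-- `A`, with generators `D`, belongs to the family `B({i, j}, S, T_a^∘, T_b^•)`. -/
def IsTypeB (D : Fin N → A) (x : Fin N → ℂ) (q : Fin N → Fin N → ℝ)
    (Rb : Finset (Finset (Fin N))) (I : Finset (Fin N)) (S : Set (Fin N))
    (Tc Tb : Set (Finset (Fin N))) : Prop :=
  ∃ i j : Fin N, i < j ∧ I = {i, j} ∧
  ∃ (g Λ : ℝ) (gs : Fin N → ℝ) (gc gp gm : Finset (Fin N) → ℝ),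
    g ≠ 0 ∧ (∀ s ∈ S, gs s ≠ 0 ∧ (s < i ∨ j < s → gs s ≠ Λ)) ∧
    (∀ a ∈ Tc, gc a ≠ 0 ∧ gc a ≠ Λ) ∧ (∀ b ∈ Tb, gp b ≠ 0 ∧ gm b ≠ 0) ∧
    IsPresentedBy D fun u v => RelB x i j S Tc Tb g Λ gs gc gp gm u v ∨ RelR q Rb u v

/-- `A`, with generators `D`, belongs to the family `C({i}, R_a)`. -/
def IsTypeC (D : Fin N → A) (x : Fin N → ℂ) (q : Fin N → Fin N → ℝ)
    (Rb : Finset (Finset (Fin N))) (I : Finset (Fin N)) : Prop :=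
  ∃ i : Fin N, I = {i} ∧
  ∃ (gr : Fin N → ℝ) (Λ : Finset (Fin N) → ℝ),
    (∀ a ∈ Rb, ∀ r ∈ a, (i < r → gr r ≠ 0) ∧ (r < i → gr r ≠ Λ a)) ∧
    IsPresentedBy D fun u v => RelC x i Rb gr Λ u v ∨ RelR q Rb u v

/-- `A`, with generators `D`, belongs to the family `D(R)`. -/
def IsTypeD (D : Fin N → A) (q : Fin N → Fin N → ℝ) (Rb : Finset (Finset (Fin N)))
    (I R : Finset (Fin N)) : Prop :=
  I = ∅ ∧ IsPresentedBy D fun u v => RelD q R u v ∨ RelR q Rb u v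

end DiffusionAlgebra

/-!
The argument reduces the theorem to identities between the real numbers `g α β`.

For `a < b < c` the product `D a * D b * D c` can be reordered in two ways. Both give the same
cubic term, and linear independence of the ordered monomials forces the coefficients of the
remaining six monomials of degree one and two to agree (`overlap_eq_zero`,
`IsDiffusionAlgebra.isConsistent`). In terms of `skew g a b = g a b - g b a` the quadratic
monomials give `skew g a c = skew g b c` whenever `x c ≠ 0` and `g a b * g b a ≠ 0`, and those
of degree one give three linear relations, one for each pair of members of the triple that may
lie in `I`. Linear independence is used for nothing else.

The blocks are the connected components of the graph on `R` in which `r`, `t` are joined when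
`g r t * g t r ≠ 0`. Since `skew g i` does not change along an edge, it is constant on every
block, for each `i ∈ I` (`IsConsistent.skew_eq_of_mem_block`).

* In an `S`-block, an element coupled with one member of `I` is coupled with all of them, so
  `skew g i s = skew g i j` throughout the block, for all `i ≠ j` in `I`; the coefficients of
  the pairs `i`, `s` and `s`, `j` are then equal (`IsSBlock.skew_eq`, `IsSBlock.coeff_eq`).
* In a `T`-block, one coefficient of each pair with `I` vanishes and the other one is `skew` up
  to sign. If `skew g i j = φ i - φ j` on `I`, then `skew g i t - φ i` is independent of `i`,
  except that for a block in a gap of `I` there are two constants, one for each side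
  (`exists_skew_eq_add_of_not_inGap`, `exists_skew_eq_of_inGap`).
* For `|I| ≥ 3`, the coefficients on `I` are all equal, or `g j i = 0` and
  `g i j = φ i - φ j` for `i < j` (`IsConsistent.eq_const_or_eq_sub`). These cases are the
  families `A_I` and `A_II`; in the second one `S`-blocks would force `φ` to take the same value
  twice. For `|I| = 2, 1, 0` the families are `B`, `C`, `D`.

With these identities, the relation of a family for each pair of generators is equivalent to the
defining relation for the same pair, so both systems of relations present the same algebra
(`IsPresentedBy.congr`, `IsDiffusionAlgebra.isPresentedBy_or_relR`).
-/

namespace DiffusionAlgebra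

/-! ### Ordered monomials of degree one and two -/

section Monomials

variable {N : ℕ} {A : Type*} [Ring A]

theorem orderedMonomial_eq_prod_map (D : Fin N → A) (k : Fin N → ℕ) {l : List (Fin N)}
    (hl : l.Pairwise (· > ·)) (hk : ∀ i, i ∉ l → k i = 0) :
    orderedMonomial D k = (l.map fun i => D i ^ k i).prod := by
  have hfilter : ∀ L : List (Fin N), (L.map fun i => D i ^ k i).prod =
      ((L.filter (· ∈ l)).map fun i => D i ^ k i).prod := by
    intro L
    induction L with
    | nil => simp
    | cons a L ih =>
      by_cases ha : a ∈ l
      · simp [ha, ih]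
      · simp [ha, ih, hk a ha]
  have hdec : ((List.finRange N).reverse).Pairwise (· > ·) := by
    rw [List.pairwise_reverse]
    exact List.pairwise_lt_finRange N
  have hperm : ((List.finRange N).reverse.filter (· ∈ l)).Perm l := by
    rw [List.perm_ext_iff_of_nodup]
    · simp
    · exact (hdec.imp fun h => ne_of_gt h).filter _
    · exact hl.imp fun h => ne_of_gt h
  have hrev : orderedMonomial D k =
      ((List.finRange N).reverse.map fun i => D i ^ k i).prod := by
    simp only [orderedMonomial, List.ofFn_eq_map, List.finRange_reverse, List.map_map]
    rfl
  rw [hrev, hfilter, hperm.eq_of_pairwise' (hdec.filter _) hl]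

theorem orderedMonomial_single (D : Fin N → A) (a : Fin N) :
    orderedMonomial D (Pi.single a 1) = D a := by
  rw [orderedMonomial_eq_prod_map D _ (l := [a]) (by simp)]
  · simp
  · intro i hi
    simp only [List.mem_singleton] at hi
    simp [hi]

theorem orderedMonomial_single_add_single (D : Fin N → A) {a b : Fin N} (hab : a < b) :
    orderedMonomial D (Pi.single a 1 + Pi.single b 1) = D b * D a := by
  rw [orderedMonomial_eq_prod_map D _ (l := [b, a]) (by simpa using hab)]
  · simp [hab.ne, hab.ne']
  · intro i hi
    simp only [List.mem_cons, List.not_mem_nil, or_false, not_or] at hi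
    simp [hi.1, hi.2]

variable [Algebra ℂ A]

/-- The six monomials of degree one and two that survive when the two ways of ordering
`D a * D b * D c` are compared are linearly independent. -/
theorem IsDiffusionAlgebra.coeffs_eq_zero {D : Fin N → A} {g : Fin N → Fin N → ℝ}
    {x : Fin N → ℂ} (h : IsDiffusionAlgebra D g x) {a b c : Fin N} (hab : a < b) (hbc : b < c)
    {r₁ r₂ r₃ r₄ r₅ r₆ : ℂ}
    (hr : r₁ • (D b * D a) + r₂ • (D c * D a) + r₃ • (D c * D b) +
      r₄ • D a + r₅ • D b + r₆ • D c = 0) :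
    r₁ = 0 ∧ r₂ = 0 ∧ r₃ = 0 ∧ r₄ = 0 ∧ r₅ = 0 ∧ r₆ = 0 := by
  have hac := hab.trans hbc
  let e : Fin 6 → Fin N → ℕ :=
    ![Pi.single a 1 + Pi.single b 1, Pi.single a 1 + Pi.single c 1,
      Pi.single b 1 + Pi.single c 1, Pi.single a 1, Pi.single b 1, Pi.single c 1]
  -- The exponents are told apart by their values at `a`, `b`, `c`.
  have he : Function.Injective e := by
    refine Function.Injective.of_comp (f := fun k : Fin N → ℕ => (k a, k b, k c)) ?_
    have : (fun k : Fin N → ℕ => (k a, k b, k c)) ∘ e =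
        ![(1, 1, 0), (1, 0, 1), (0, 1, 1), (1, 0, 0), (0, 1, 0), (0, 0, 1)] := by
      funext i
      fin_cases i <;> simp [e, hab.ne, hab.ne', hbc.ne, hbc.ne', hac.ne, hac.ne']
    rw [this]
    decide
  have hli := Fintype.linearIndependent_iff.mp (h.linearIndependent.comp e he)
    ![r₁, r₂, r₃, r₄, r₅, r₆] (by
      simpa [Fin.sum_univ_succ, e, orderedMonomial_single,
        orderedMonomial_single_add_single D hab, orderedMonomial_single_add_single D hbc,
        orderedMonomial_single_add_single D hac, add_assoc] using hr)
  exact ⟨hli 0, hli 1, hli 2, hli 3, hli 4, hli 5⟩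

end Monomials

/-! ### Consistency of the quadratic relations -/

/-- The overlap of the rewriting rules `PQ → QP`, `PR → RP`, `QR → RQ`: both ways of
reordering `PQR` start with the same cubic term, and the difference of the remaining terms is
the left-hand side below. -/
theorem overlap_eq_zero {A : Type*} [Ring A] [Algebra ℂ A] {P Q R : A}
    {q₁₂ u₁₂ v₁₂ q₁₃ u₁₃ v₁₃ q₂₃ u₂₃ v₂₃ : ℂ}
    (h₁₂ : P * Q = q₁₂ • (Q * P) + u₁₂ • P - v₁₂ • Q)
    (h₁₃ : P * R = q₁₃ • (R * P) + u₁₃ • P - v₁₃ • R)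
    (h₂₃ : Q * R = q₂₃ • (R * Q) + u₂₃ • Q - v₂₃ • R) :
    (q₁₂ * ((q₁₃ - 1) * u₂₃ + (1 - q₂₃) * u₁₃)) • (Q * P) +
      (q₁₃ * (u₁₂ * (1 - q₂₃) + v₂₃ * (1 - q₁₂))) • (R * P) +
      (-(q₂₃ * (v₁₃ * (q₁₂ - 1) + v₁₂ * (1 - q₁₃)))) • (R * Q) +
      (u₁₂ * u₁₃ * (1 - q₂₃) - u₂₃ * u₁₂ + v₂₃ * u₁₃) • P +
      (q₂₃ * u₁₃ * v₁₂ - q₁₂ * v₁₃ * u₂₃) • Q +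
      (v₁₃ * v₂₃ * (q₁₂ - 1) - u₁₂ * v₁₃ + v₁₂ * v₂₃) • R = 0 := by
  have hl : P * Q * R = q₁₂ • (q₁₃ • ((q₂₃ • (R * Q) + u₂₃ • Q - v₂₃ • R) * P) +
      u₁₃ • (Q * P) - v₁₃ • (q₂₃ • (R * Q) + u₂₃ • Q - v₂₃ • R)) +
      u₁₂ • (q₁₃ • (R * P) + u₁₃ • P - v₁₃ • R) -
      v₁₂ • (q₂₃ • (R * Q) + u₂₃ • Q - v₂₃ • R) := by
    rw [← h₂₃, ← h₁₃, h₁₂]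
    simp only [sub_mul, add_mul, smul_mul_assoc]
    rw [mul_assoc Q P R, h₁₃]
    simp only [mul_sub, mul_add, mul_smul_comm, mul_assoc]
  have hr : P * (Q * R) = q₂₃ • (q₁₃ • (R * (q₁₂ • (Q * P) + u₁₂ • P - v₁₂ • Q)) +
      u₁₃ • (q₁₂ • (Q * P) + u₁₂ • P - v₁₂ • Q) - v₁₃ • (R * Q)) +
      u₂₃ • (q₁₂ • (Q * P) + u₁₂ • P - v₁₂ • Q) -
      v₂₃ • (q₁₃ • (R * P) + u₁₃ • P - v₁₃ • R) := by
    rw [← h₁₂, ← h₁₃, h₂₃]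
    simp only [mul_sub, mul_add, mul_smul_comm]
    rw [← mul_assoc P R Q, h₁₃]
    simp only [sub_mul, add_mul, smul_mul_assoc, mul_assoc]
  rw [mul_assoc, hr, ← sub_eq_zero] at hl
  rw [← neg_eq_zero, ← hl]
  simp only [mul_sub, mul_add, mul_smul_comm, sub_mul, add_mul, smul_mul_assoc, mul_assoc]
  module

section Conditions

variable {N : ℕ}

/-- The antisymmetric part `g i j - g j i` of the coefficients. -/
def skew (g : Fin N → Fin N → ℝ) (i j : Fin N) : ℝ := g i j - g j i

theorem skew_self (g : Fin N → Fin N → ℝ) (i : Fin N) : skew g i i = 0 := sub_self _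

theorem neg_skew (g : Fin N → Fin N → ℝ) (i j : Fin N) : -skew g i j = skew g j i :=
  neg_sub _ _

/-- The conditions on the structure constants that come from reordering `D a * D b * D c` in
two ways. In `below`, `between` and `above` the pair with nonzero `x` is `b, c`, `a, c` and
`a, b`: the names give the position of the third index relative to it. -/
structure IsConsistent (g : Fin N → Fin N → ℝ) (x : Fin N → ℂ) : Prop where
  coeff_ne_zero : ∀ a b, a < b → g a b ≠ 0
  skew_eq : ∀ a b c, a ≠ b → a ≠ c → b ≠ c → x c ≠ 0 → g a b * g b a ≠ 0 →
    skew g a c = skew g b c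
  below : ∀ a b c, a < b → b < c → x b ≠ 0 → x c ≠ 0 → g a c = g a b + skew g b c
  between : ∀ a b c, a < b → b < c → x a ≠ 0 → x c ≠ 0 → g b a = g c b
  above : ∀ a b c, a < b → b < c → x a ≠ 0 → x b ≠ 0 → g a c = g b c + skew g a b

theorem IsDiffusionAlgebra.mul_eq {A : Type*} [Ring A] [Algebra ℂ A] {D : Fin N → A}
    {g : Fin N → Fin N → ℝ} {x : Fin N → ℂ} (h : IsDiffusionAlgebra D g x) {a b : Fin N}
    (hab : a < b) :
    D a * D b = ((g b a : ℂ) / g a b) • (D b * D a) + (x b / g a b) • D a -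
      (x a / g a b) • D b := by
  obtain ⟨e, he⟩ := h.presented
  have h0 : (g a b : ℂ) ≠ 0 := by exact_mod_cast h.coeff_ne_zero a b hab
  have := congrArg e (RingQuot.mkAlgHom_rel ℂ (QuadraticRel.rel (g := g) (x := x) a b hab))
  simp only [map_sub, map_smul, map_mul, he] at this
  have h2 : D a * D b = (g a b : ℂ)⁻¹ • ((g a b : ℂ) • (D a * D b)) := by
    rw [smul_smul, inv_mul_cancel₀ h0, one_smul]
  rw [h2, sub_eq_iff_eq_add.mp this]
  simp only [div_eq_inv_mul]
  module

theorem IsDiffusionAlgebra.overlap_coeffs {A : Type*} [Ring A] [Algebra ℂ A] {D : Fin N → A}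
    {g : Fin N → Fin N → ℝ} {x : Fin N → ℂ} (h : IsDiffusionAlgebra D g x) {a b c : Fin N}
    (hab : a < b) (hbc : b < c) :
    (x c ≠ 0 → g a b * g b a ≠ 0 → skew g a c = skew g b c) ∧
    (x b ≠ 0 → g a c * g c a ≠ 0 → skew g a b = skew g c b) ∧
    (x a ≠ 0 → g b c * g c b ≠ 0 → skew g b a = skew g c a) ∧
    (x b ≠ 0 → x c ≠ 0 → g a c = g a b + skew g b c) ∧
    (x a ≠ 0 → x c ≠ 0 → g b a = g c b) ∧
    (x a ≠ 0 → x b ≠ 0 → g a c = g b c + skew g a b) := by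
  have hac := hab.trans hbc
  have h₁₂ : (g a b : ℂ) ≠ 0 := by exact_mod_cast h.coeff_ne_zero a b hab
  have h₁₃ : (g a c : ℂ) ≠ 0 := by exact_mod_cast h.coeff_ne_zero a c hac
  have h₂₃ : (g b c : ℂ) ≠ 0 := by exact_mod_cast h.coeff_ne_zero b c hbc
  obtain ⟨e₁, e₂, e₃, e₄, e₅, e₆⟩ := h.coeffs_eq_zero hab hbc
    (overlap_eq_zero (h.mul_eq hab) (h.mul_eq hac) (h.mul_eq hbc))
  field_simp at e₁ e₂ e₃ e₄ e₅ e₆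
  simp only [mul_zero, neg_eq_zero] at e₁ e₂ e₃ e₄ e₅ e₆
  simp only [skew]
  refine ⟨fun hx hg => ?_, fun hx hg => ?_, fun hx hg => ?_, fun hx hy => ?_, fun hx hy => ?_,
    fun hx hy => ?_⟩
  · have hg' : (g b a : ℂ) ≠ 0 := by exact_mod_cast right_ne_zero_of_mul hg
    have := (mul_eq_zero.mp e₁).resolve_left (mul_ne_zero hg' hx)
    norm_cast at this
    linarith
  · have hg' : (g c a : ℂ) ≠ 0 := by exact_mod_cast right_ne_zero_of_mul hg
    have := (mul_eq_zero.mp e₂).resolve_left (mul_ne_zero hg' hx)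
    norm_cast at this
    linarith
  · have hg' : (g c b : ℂ) ≠ 0 := by exact_mod_cast right_ne_zero_of_mul hg
    have := (mul_eq_zero.mp e₃).resolve_left (mul_ne_zero hg' hx)
    norm_cast at this
    linarith
  · have := (mul_eq_zero.mp e₄).resolve_left (mul_ne_zero hy hx)
    norm_cast at this
    linarith
  · have := (mul_eq_zero.mp e₅).resolve_left (mul_ne_zero hy hx)
    norm_cast at this
    linarith
  · have := (mul_eq_zero.mp e₆).resolve_left (mul_ne_zero hy hx)
    norm_cast at this
    linarith

theorem IsDiffusionAlgebra.isConsistent {A : Type*} [Ring A] [Algebra ℂ A] {D : Fin N → A}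
    {g : Fin N → Fin N → ℝ} {x : Fin N → ℂ} (h : IsDiffusionAlgebra D g x) :
    IsConsistent g x where
  coeff_ne_zero := h.coeff_ne_zero
  skew_eq a b c hab hac hbc hx hg := by
    have hg' : g b a * g a b ≠ 0 := by rwa [mul_comm]
    rcases lt_or_gt_of_ne hab with h₁ | h₁ <;> rcases lt_or_gt_of_ne hac with h₂ | h₂ <;>
      rcases lt_or_gt_of_ne hbc with h₃ | h₃
    · exact (h.overlap_coeffs h₁ h₃).1 hx hg
    · exact (h.overlap_coeffs h₂ h₃).2.1 hx hg
    · exact absurd (h₁.trans h₃) h₂.not_gt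
    · exact (h.overlap_coeffs h₂ h₁).2.2.1 hx hg
    · exact ((h.overlap_coeffs h₁ h₂).1 hx hg').symm
    · exact absurd (h₂.trans h₃) h₁.not_gt
    · exact ((h.overlap_coeffs h₃ h₂).2.1 hx hg').symm
    · exact ((h.overlap_coeffs h₃ h₁).2.2.1 hx hg').symm
  below a b c hab hbc := (h.overlap_coeffs hab hbc).2.2.2.1
  between a b c hab hbc := (h.overlap_coeffs hab hbc).2.2.2.2.1
  above a b c hab hbc := (h.overlap_coeffs hab hbc).2.2.2.2.2

end Conditions

/-! ### Blocks of coupled indices -/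

section Blocks

variable {N : ℕ}

/-- A block is connected when every splitting into two nonempty parts is crossed by a pair
`r₁`, `r₂` with `g r₁ r₂ * g r₂ r₁ ≠ 0`. -/
def IsConnectedBlock (g : Fin N → Fin N → ℝ) (a : Finset (Fin N)) : Prop :=
  ∀ a' a'' : Finset (Fin N), a'.Nonempty → a''.Nonempty → Disjoint a' a'' → a' ∪ a'' = a →
    ∃ r₁ ∈ a', ∃ r₂ ∈ a'', g r₁ r₂ * g r₂ r₁ ≠ 0

/-- The blocks are the connected components of the graph on `R` whose edges are the pairs with
`g r t * g t r ≠ 0`. -/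
theorem exists_finpartition_isConnectedBlock (g : Fin N → Fin N → ℝ) (R : Finset (Fin N)) :
    ∃ P : Finpartition R,
      (∀ a ∈ P.parts, ∀ b ∈ P.parts, a ≠ b → ∀ r ∈ a, ∀ t ∈ b, g r t * g t r = 0) ∧
      ∀ a ∈ P.parts, IsConnectedBlock g a := by
  classical
  let s : Setoid (Fin N) :=
    Relation.EqvGen.setoid fun r t => r ∈ R ∧ t ∈ R ∧ g r t * g t r ≠ 0
  let P := Finpartition.ofSetSetoid s R
  have hpart : ∀ a ∈ P.parts, ∀ r ∈ a, ∀ t, t ∈ a ↔ t ∈ R ∧ s r t := by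
    intro a ha r hr t
    have hrR : r ∈ R := P.le ha hr
    rw [← P.part_eq_of_mem ha hr, Finpartition.mem_part_ofSetSetoid_iff_rel]
    simp [hrR]
  refine ⟨P, fun a ha b hb hab r hr t ht => ?_, fun a ha a' a'' hne' hne'' hdisj hun => ?_⟩
  · by_contra hg
    have : t ∈ a := (hpart a ha r hr t).2
      ⟨P.le hb ht, Relation.EqvGen.rel _ _ ⟨P.le ha hr, P.le hb ht, hg⟩⟩
    exact Finset.disjoint_left.mp (P.disjoint ha hb hab) this ht
  · by_contra! hno
    obtain ⟨r, hr⟩ := hne'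
    obtain ⟨t, ht⟩ := hne''
    have hra : r ∈ a := hun ▸ Finset.mem_union_left _ hr
    have hta : t ∈ a := hun ▸ Finset.mem_union_right _ ht
    have hstep : ∀ u v, u ∈ R → v ∈ R → g u v * g v u ≠ 0 → u ∈ a' → v ∈ a' := by
      intro u v huR hvR hg hu
      have hua : u ∈ a := hun ▸ Finset.mem_union_left _ hu
      have hva : v ∈ a := (hpart a ha u hua v).2
        ⟨hvR, Relation.EqvGen.rel _ _ ⟨huR, hvR, hg⟩⟩
      rw [← hun, Finset.mem_union] at hva
      exact hva.resolve_right fun hv => hg (hno u hu v hv)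
    have hinv : ∀ u v, Relation.EqvGen (fun r t => r ∈ R ∧ t ∈ R ∧ g r t * g t r ≠ 0) u v →
        (u ∈ a' ↔ v ∈ a') := by
      intro u v h
      induction h with
      | rel u v h => exact ⟨hstep u v h.1 h.2.1 h.2.2, hstep v u h.2.1 h.1 (by
          rw [mul_comm]; exact h.2.2)⟩
      | refl u => exact Iff.rfl
      | symm u v _ ih => exact ih.symm
      | trans u v w _ _ ih₁ ih₂ => exact ih₁.trans ih₂
    exact Finset.disjoint_left.mp hdisj
      ((hinv r t ((hpart a ha r hra t).1 hta).2).1 hr) ht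

theorem IsConnectedBlock.eq_of_mem {g : Fin N → Fin N → ℝ} {a : Finset (Fin N)}
    (ha : IsConnectedBlock g a) {β : Type*} {f : Fin N → β}
    (hf : ∀ r ∈ a, ∀ t ∈ a, g r t * g t r ≠ 0 → f r = f t) {r t : Fin N} (hr : r ∈ a)
    (ht : t ∈ a) : f r = f t := by
  classical
  by_contra hne
  obtain ⟨u, hu, v, hv, hg⟩ := ha {u ∈ a | f u = f r} {u ∈ a | ¬ f u = f r} ⟨r, by simp [hr]⟩
    ⟨t, by simpa [ht] using fun h => hne h.symm⟩ (Finset.disjoint_filter_filter_not _ _ _)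
    (Finset.filter_union_filter_not_eq _ _)
  rw [Finset.mem_filter] at hu hv
  exact hv.2 ((hf u hu.1 v hv.1 hg) ▸ hu.2)

theorem mem_indexI {x : Fin N → ℂ} {α : Fin N} : α ∈ indexI x ↔ x α ≠ 0 := by
  simp [indexI]

theorem mem_indexR {x : Fin N → ℂ} {α : Fin N} : α ∈ indexR x ↔ x α = 0 := by
  simp [indexR]

variable {g : Fin N → Fin N → ℝ} {x : Fin N → ℂ}

theorem ne_of_mem_indexI_of_mem_indexR {i r : Fin N} (hi : i ∈ indexI x) (hr : r ∈ indexR x) :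
    i ≠ r := by
  rintro rfl
  exact mem_indexI.1 hi (mem_indexR.1 hr)

theorem IsConsistent.eq_zero_of_uncoupled (hg : IsConsistent g x) {i t : Fin N} (h : i < t)
    (h0 : g i t * g t i = 0) : g t i = 0 :=
  (mul_eq_zero.mp h0).resolve_left (hg.coeff_ne_zero i t h)

theorem IsConsistent.skew_ne_zero (hg : IsConsistent g x) {i t : Fin N} (h : i ≠ t)
    (h0 : g i t * g t i = 0) : skew g i t ≠ 0 := by
  rcases lt_or_gt_of_ne h with h | h
  · simpa [skew, hg.eq_zero_of_uncoupled h h0] using hg.coeff_ne_zero i t h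
  · rw [mul_comm] at h0
    simpa [skew, hg.eq_zero_of_uncoupled h h0] using hg.coeff_ne_zero t i h

/-- Along an edge of a block, `skew g i` does not change; hence it is constant on the block. -/
theorem IsConsistent.skew_eq_of_mem_block (hg : IsConsistent g x) {a : Finset (Fin N)}
    (ha : IsConnectedBlock g a) (haR : a ⊆ indexR x) {i r t : Fin N} (hi : i ∈ indexI x)
    (hr : r ∈ a) (ht : t ∈ a) : skew g i r = skew g i t := by
  refine ha.eq_of_mem (f := fun r => skew g i r) (fun u hu v hv huv => ?_) hr ht
  rcases eq_or_ne u v with rfl | hne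
  · rfl
  have := hg.skew_eq u v i hne (ne_of_mem_indexI_of_mem_indexR hi (haR hu)).symm
    (ne_of_mem_indexI_of_mem_indexR hi (haR hv)).symm (mem_indexI.1 hi) huv
  rw [← neg_skew, this, neg_skew]

/-! ### Coupled blocks -/

/-- If `skew g r j = skew g i j`, then exchanging `i` and `j` in the two coefficients of the pair
`i`, `r` gives one of the coefficients of the pair `j`, `r`, namely the one that is not
nonzero for free. -/
theorem IsConsistent.coeff_eq_of_skew_eq (hg : IsConsistent g x) {i j r : Fin N}
    (hi : i ∈ indexI x) (hj : j ∈ indexI x) (hij : i ≠ j) (hr : r ∈ indexR x)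
    (h : skew g i j = skew g r j) :
    (r < j → g j r = g r i) ∧ (j < r → g r j = g i r) := by
  have hir := ne_of_mem_indexI_of_mem_indexR hi hr
  have hxi := mem_indexI.1 hi
  have hxj := mem_indexI.1 hj
  simp only [skew] at h
  refine ⟨fun hrj => ?_, fun hjr => ?_⟩
  · rcases lt_or_gt_of_ne hir with h₁ | h₁
    · exact (hg.between i r j h₁ hrj hxi hxj).symm
    · rcases lt_or_gt_of_ne hij with h₂ | h₂
      · have := hg.below r i j h₁ h₂ hxi hxj
        simp only [skew] at this
        linarith
      · have := hg.below r j i hrj h₂ hxj hxi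
        simp only [skew] at this
        linarith
  · rcases lt_or_gt_of_ne hir with h₁ | h₁
    · rcases lt_or_gt_of_ne hij with h₂ | h₂
      · have := hg.above i j r h₂ hjr hxi hxj
        simp only [skew] at this
        linarith
      · have := hg.above j i r h₂ h₁ hxj hxi
        simp only [skew] at this
        linarith
    · exact hg.between j r i hjr h₁ hxj hxi

/-- An index coupled with one element of `I` is coupled with all of them. -/
theorem IsConsistent.coupled_of_coupled (hg : IsConsistent g x) {i j r : Fin N}
    (hi : i ∈ indexI x) (hj : j ∈ indexI x) (hr : r ∈ indexR x) (h : g i r * g r i ≠ 0) :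
    g j r * g r j ≠ 0 := by
  rcases eq_or_ne i j with rfl | hij
  · exact h
  have hir := ne_of_mem_indexI_of_mem_indexR hi hr
  have hjr := ne_of_mem_indexI_of_mem_indexR hj hr
  obtain ⟨e₁, e₂⟩ := hg.coeff_eq_of_skew_eq hi hj hij hr
    (hg.skew_eq i r j hir hij hjr.symm (mem_indexI.1 hj) h)
  obtain ⟨n₁, n₂⟩ := mul_ne_zero_iff.1 h
  rcases lt_or_gt_of_ne hjr with hlt | hlt
  · exact mul_ne_zero (hg.coeff_ne_zero j r hlt) (e₂ hlt ▸ n₁)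
  · exact mul_ne_zero (e₁ hlt ▸ n₂) (hg.coeff_ne_zero r j hlt)

theorem IsSBlock.coupled (hg : IsConsistent g x) {a : Finset (Fin N)}
    (haR : a ⊆ indexR x) (h : IsSBlock g x a) :
    ∃ r ∈ a, ∀ i ∈ indexI x, g i r * g r i ≠ 0 := by
  obtain ⟨r, hr, i, hi, h⟩ := h
  exact ⟨r, hr, fun j hj => hg.coupled_of_coupled hi hj (haR hr) h⟩

/-- In a coupled block, `skew g i s` is forced by the coefficients on `I`: this holds at an
element coupled with all of `I` and spreads over the block by connectedness. -/
theorem IsSBlock.skew_eq (hg : IsConsistent g x) {a : Finset (Fin N)}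
    (hc : IsConnectedBlock g a) (haR : a ⊆ indexR x) (h : IsSBlock g x a) {i j s : Fin N}
    (hi : i ∈ indexI x) (hj : j ∈ indexI x) (hij : i ≠ j) (hs : s ∈ a) :
    skew g i s = skew g i j := by
  obtain ⟨r, hr, h⟩ := h.coupled hg haR
  rw [hg.skew_eq_of_mem_block hc haR hi hs hr]
  have := hg.skew_eq r j i (ne_of_mem_indexI_of_mem_indexR hj (haR hr)).symm
    (ne_of_mem_indexI_of_mem_indexR hi (haR hr)).symm hij.symm (mem_indexI.1 hi)
    (by rw [mul_comm]; exact h j hj)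
  rw [← neg_skew, this, neg_skew]

theorem IsSBlock.coeff_eq (hg : IsConsistent g x) {a : Finset (Fin N)}
    (hc : IsConnectedBlock g a) (haR : a ⊆ indexR x) (h : IsSBlock g x a) {i j s : Fin N}
    (hi : i ∈ indexI x) (hj : j ∈ indexI x) (hij : i ≠ j) (hs : s ∈ a) :
    g i s = g s j := by
  have h₁ := h.skew_eq hg hc haR hi hj hij hs
  have h₂ := h.skew_eq hg hc haR hj hi hij.symm hs
  obtain ⟨e₁, e₂⟩ := hg.coeff_eq_of_skew_eq hi hj hij (haR hs)
    (by rw [← neg_skew, ← h₂, neg_skew])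
  rcases lt_or_gt_of_ne (ne_of_mem_indexI_of_mem_indexR hj (haR hs)) with hlt | hlt
  · exact (e₂ hlt).symm
  · have := e₁ hlt
    simp only [skew] at h₁ h₂
    linarith

/-! ### Uncoupled blocks -/

/-- For an index outside the interval from `i` to `j` and uncoupled from both, one of the two
coefficients of each pair vanishes, so that the condition on the triple becomes additivity of
`skew`. Inside the interval there is no such relation. -/
theorem IsConsistent.skew_sub_skew (hg : IsConsistent g x) {i j r : Fin N}
    (hi : i ∈ indexI x) (hj : j ∈ indexI x) (hij : i < j)
    (hout : r < i ∨ j < r) (hir : g i r * g r i = 0) (hjr : g j r * g r j = 0) :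
    skew g i r - skew g j r = skew g i j := by
  have hxi := mem_indexI.1 hi
  have hxj := mem_indexI.1 hj
  rcases hout with h | h
  · have h₁ := hg.eq_zero_of_uncoupled h (by rwa [mul_comm])
    have h₂ := hg.eq_zero_of_uncoupled (h.trans hij) (by rwa [mul_comm])
    have h₃ := hg.below _ _ _ h hij hxi hxj
    simp only [skew] at h₃ ⊢
    linarith
  · have h₁ := hg.eq_zero_of_uncoupled h hjr
    have h₂ := hg.eq_zero_of_uncoupled (hij.trans h) hir
    have h₃ := hg.above _ _ _ hij h hxi hxj
    simp only [skew] at h₃ ⊢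
    linarith

/-- If every element of `I` lies on one side of the block `a`, and both sides occur, then the
largest element of `I` below `a` and the smallest one above it are consecutive in `I`. -/
theorem inGap_of_forall {a : Finset (Fin N)} (hne : a.Nonempty)
    (hlow : ∃ i ∈ indexI x, ∀ t ∈ a, i < t) (hup : ∃ j ∈ indexI x, ∀ t ∈ a, t < j)
    (h : ∀ k ∈ indexI x, (∀ t ∈ a, k < t) ∨ ∀ t ∈ a, t < k) : InGap x a := by
  classical
  obtain ⟨t₀, ht₀⟩ := hne
  let L := {i ∈ indexI x | ∀ t ∈ a, i < t}
  let U := {j ∈ indexI x | ∀ t ∈ a, t < j}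
  have hL : L.Nonempty := by
    obtain ⟨i, hi, h⟩ := hlow
    exact ⟨i, Finset.mem_filter.2 ⟨hi, h⟩⟩
  have hU : U.Nonempty := by
    obtain ⟨i, hi, h⟩ := hup
    exact ⟨i, Finset.mem_filter.2 ⟨hi, h⟩⟩
  obtain ⟨hiI, hi⟩ := Finset.mem_filter.1 (L.max'_mem hL)
  obtain ⟨hjI, hj⟩ := Finset.mem_filter.1 (U.min'_mem hU)
  refine ⟨_, hiI, _, hjI, (hi t₀ ht₀).trans (hj t₀ ht₀), fun t ht => ⟨hi t ht, hj t ht⟩, ?_⟩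
  rintro k hk ⟨h₁, h₂⟩
  rcases h k hk with h | h
  · exact (L.le_max' k (Finset.mem_filter.2 ⟨hk, h⟩)).not_gt h₁
  · exact (U.min'_le k (Finset.mem_filter.2 ⟨hk, h⟩)).not_gt h₂

theorem uncoupled_of_not_isSBlock {a : Finset (Fin N)} (h : ¬ IsSBlock g x a) {i t : Fin N}
    (hi : i ∈ indexI x) (ht : t ∈ a) : g i t * g t i = 0 := by
  by_contra h'
  exact h ⟨t, ht, i, hi, h'⟩

/-- If the block `a` is uncoupled from `I` and is not in a gap of `I`, then
`skew g i t - φ i` does not depend on `i`. A pair `i < j` enclosing `a` is handled through an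
intermediate `k` that has elements of `a` on both sides. -/
theorem exists_skew_eq_add_of_not_inGap (hg : IsConsistent g x) {a : Finset (Fin N)}
    (hc : IsConnectedBlock g a) (haR : a ⊆ indexR x) (hne : a.Nonempty)
    (hS : ¬ IsSBlock g x a) (hgap : ¬ InGap x a) {φ : Fin N → ℝ}
    (hφ : ∀ i ∈ indexI x, ∀ j ∈ indexI x, skew g i j = φ i - φ j) :
    ∃ c, ∀ t ∈ a, ∀ i ∈ indexI x, skew g i t = φ i + c := by
  have hout : ∀ i ∈ indexI x, ∀ j ∈ indexI x, i < j → ∀ r ∈ a, (r < i ∨ j < r) → ∀ t ∈ a,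
      skew g i t - φ i = skew g j t - φ j := by
    intro i hi j hj hij r hr hrout t ht
    have h := hg.skew_sub_skew hi hj hij hrout (uncoupled_of_not_isSBlock hS hi hr)
      (uncoupled_of_not_isSBlock hS hj hr)
    rw [hφ i hi j hj, hg.skew_eq_of_mem_block hc haR hi hr ht,
      hg.skew_eq_of_mem_block hc haR hj hr ht] at h
    linarith
  have hlt : ∀ i ∈ indexI x, ∀ j ∈ indexI x, i < j → ∀ t ∈ a,
      skew g i t - φ i = skew g j t - φ j := by
    intro i hi j hj hij t ht
    by_cases hr : ∃ r ∈ a, r < i ∨ j < r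
    · obtain ⟨r, hra, hrout⟩ := hr
      exact hout i hi j hj hij r hra hrout t ht
    push Not at hr
    have hlow : ∀ t ∈ a, i < t := fun t ht =>
      lt_of_le_of_ne (hr t ht).1 (ne_of_mem_indexI_of_mem_indexR hi (haR ht))
    have hup : ∀ t ∈ a, t < j := fun t ht =>
      lt_of_le_of_ne (hr t ht).2 (ne_of_mem_indexI_of_mem_indexR hj (haR ht)).symm
    have hk : ¬ ∀ k ∈ indexI x, (∀ t ∈ a, k < t) ∨ ∀ t ∈ a, t < k := fun h =>
      hgap (inGap_of_forall hne ⟨i, hi, hlow⟩ ⟨j, hj, hup⟩ h)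
    push Not at hk
    obtain ⟨k, hk, ⟨t₁, ht₁, h₁⟩, ⟨t₂, ht₂, h₂⟩⟩ := hk
    have h₁' : t₁ < k := lt_of_le_of_ne h₁ (ne_of_mem_indexI_of_mem_indexR hk (haR ht₁)).symm
    have h₂' : k < t₂ := lt_of_le_of_ne h₂ (ne_of_mem_indexI_of_mem_indexR hk (haR ht₂))
    rw [hout i hi k hk ((hlow t₁ ht₁).trans h₁') t₂ ht₂ (Or.inr h₂') t ht,
      hout k hk j hj (h₂'.trans (hup t₂ ht₂)) t₁ ht₁ (Or.inl h₁') t ht]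
  by_cases hI : (indexI x).Nonempty
  · obtain ⟨i₀, hi₀⟩ := hI
    obtain ⟨t₀, ht₀⟩ := hne
    refine ⟨skew g i₀ t₀ - φ i₀, fun t ht i hi => ?_⟩
    rw [hg.skew_eq_of_mem_block hc haR hi ht ht₀]
    rcases lt_trichotomy i i₀ with h | rfl | h
    · linarith [hlt i hi i₀ hi₀ h t₀ ht₀]
    · ring
    · linarith [hlt i₀ hi₀ i hi h t₀ ht₀]
  · exact ⟨0, fun t ht i hi => absurd ⟨i, hi⟩ hI⟩

/-- If the block `a` is uncoupled from `I` and lies in a gap of `I`, then `skew g i t - φ i`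
is one constant for `i` below the gap and another one for `i` above it. -/
theorem exists_skew_eq_of_inGap (hg : IsConsistent g x) {a : Finset (Fin N)}
    (hc : IsConnectedBlock g a) (haR : a ⊆ indexR x) (hne : a.Nonempty)
    (hS : ¬ IsSBlock g x a) (hgap : InGap x a) {φ : Fin N → ℝ}
    (hφ : ∀ i ∈ indexI x, ∀ j ∈ indexI x, skew g i j = φ i - φ j) :
    (∃ p, ∀ t ∈ a, ∀ i ∈ indexI x, i < t → skew g i t = φ i + p) ∧
      ∃ m, ∀ t ∈ a, ∀ i ∈ indexI x, t < i → skew g i t = φ i - m := by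
  obtain ⟨t₀, ht₀⟩ := hne
  obtain ⟨i, hi, j, hj, -, hin, hno⟩ := hgap
  refine ⟨⟨skew g i t₀ - φ i, fun t ht k hk hkt => ?_⟩,
    ⟨φ j - skew g j t₀, fun t ht k hk hkt => ?_⟩⟩
  · rw [hg.skew_eq_of_mem_block hc haR hk ht ht₀]
    have hki : k ≤ i := by
      by_contra! h
      exact hno k hk ⟨h, hkt.trans (hin t ht).2⟩
    rcases hki.eq_or_lt with rfl | hki
    · ring
    have h := hg.skew_sub_skew hk hi hki (Or.inr (hin t₀ ht₀).1)
      (uncoupled_of_not_isSBlock hS hk ht₀) (uncoupled_of_not_isSBlock hS hi ht₀)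
    linarith [hφ k hk i hi]
  · rw [hg.skew_eq_of_mem_block hc haR hk ht ht₀]
    have hjk : j ≤ k := by
      by_contra! h
      exact hno k hk ⟨(hin t ht).1.trans hkt, h⟩
    rcases hjk.eq_or_lt with rfl | hjk
    · ring
    have h := hg.skew_sub_skew hj hk hjk (Or.inl (hin t₀ ht₀).2)
      (uncoupled_of_not_isSBlock hS hj ht₀) (uncoupled_of_not_isSBlock hS hk ht₀)
    linarith [hφ j hj k hk]

/-! ### The coefficients on `I` -/

/-- In a triple from `I`, either the three coefficients `g b a` with `a < b` vanish, or
all six coefficients agree. -/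
theorem IsConsistent.triple_eq (hg : IsConsistent g x) {a b c : Fin N} (hab : a < b)
    (hbc : b < c) (ha : a ∈ indexI x) (hb : b ∈ indexI x) (hc : c ∈ indexI x) :
    (g b a = 0 ∧ g c a = 0 ∧ g c b = 0) ∨
      (g b a = g a b ∧ g a c = g a b ∧ g c a = g a b ∧ g b c = g a b ∧ g c b = g a b) := by
  have hac := hab.trans hbc
  have hxa := mem_indexI.1 ha
  have hxb := mem_indexI.1 hb
  have hxc := mem_indexI.1 hc
  have h₁ := hg.below a b c hab hbc hxb hxc
  have h₂ := hg.between a b c hab hbc hxa hxc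
  have nab := hg.coeff_ne_zero a b hab
  have nac := hg.coeff_ne_zero a c hac
  have nbc := hg.coeff_ne_zero b c hbc
  have k₁ := hg.skew_eq a b c hab.ne hac.ne hbc.ne hxc
  have k₂ := hg.skew_eq a c b hac.ne hab.ne hbc.ne' hxb
  have k₃ := hg.skew_eq b c a hbc.ne hab.ne' hac.ne' hxa
  simp only [skew] at h₁ k₁ k₂ k₃
  by_cases hba : g b a = 0
  · left
    refine ⟨hba, ?_, by rw [← h₂, hba]⟩
    by_contra hca
    have := k₂ (mul_ne_zero nac hca)
    apply nac
    linarith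
  · right
    have l₁ := k₁ (mul_ne_zero nab hba)
    have l₃ := k₃ (mul_ne_zero nbc (h₂ ▸ hba))
    have hca : g c a ≠ 0 := by
      intro hca
      apply nab
      linarith
    have l₂ := k₂ (mul_ne_zero nac hca)
    refine ⟨?_, ?_, ?_, ?_, ?_⟩ <;> linarith

theorem IsConsistent.eq_of_coupled (hg : IsConsistent g x) {a b c : Fin N} (hab : a ≠ b)
    (hac : a ≠ c) (hbc : b ≠ c) (ha : a ∈ indexI x) (hb : b ∈ indexI x) (hc : c ∈ indexI x)
    (h : g a b * g b a ≠ 0) :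
    g b a = g a b ∧ g a c = g a b ∧ g c a = g a b ∧ g b c = g a b ∧ g c b = g a b := by
  obtain ⟨n₁, n₂⟩ := mul_ne_zero_iff.1 h
  rcases lt_or_gt_of_ne hab with h₁ | h₁ <;> rcases lt_or_gt_of_ne hac with h₂ | h₂ <;>
    rcases lt_or_gt_of_ne hbc with h₃ | h₃
  · have := hg.triple_eq h₁ h₃ ha hb hc; grind
  · have := hg.triple_eq h₂ h₃ ha hc hb; grind
  · exact absurd (h₁.trans h₃) h₂.not_gt
  · have := hg.triple_eq h₂ h₁ hc ha hb; grind
  · have := hg.triple_eq h₁ h₂ hb ha hc; grind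
  · exact absurd (h₂.trans h₃) h₁.not_gt
  · have := hg.triple_eq h₃ h₂ hb hc ha; grind
  · have := hg.triple_eq h₃ h₁ hc hb ha; grind

/-- For `|I| ≥ 3` the coefficients on `I` are either all equal, or supported on `i < j` and
given there by the differences of a potential. -/
theorem IsConsistent.eq_const_or_eq_sub (hg : IsConsistent g x) (h3 : 3 ≤ (indexI x).card) :
    (∃ G ≠ 0, ∀ i ∈ indexI x, ∀ j ∈ indexI x, i ≠ j → g i j = G) ∨
      ∃ φ : Fin N → ℝ, ∀ i ∈ indexI x, ∀ j ∈ indexI x, i < j →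
        g j i = 0 ∧ g i j = φ i - φ j := by
  classical
  by_cases hex : ∃ i ∈ indexI x, ∃ j ∈ indexI x, i ≠ j ∧ g i j * g j i ≠ 0
  · left
    obtain ⟨i, hi, j, hj, hij, h⟩ := hex
    have hcard : ({i, j} : Finset (Fin N)).card < (indexI x).card := by
      rw [Finset.card_pair hij]; omega
    obtain ⟨m, hm, hmij⟩ := Finset.exists_mem_notMem_of_card_lt_card hcard
    simp only [Finset.mem_insert, Finset.mem_singleton, not_or] at hmij
    have hji := (hg.eq_of_coupled hij (Ne.symm hmij.1) (Ne.symm hmij.2) hi hj hm h).1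
    obtain ⟨n₁, -⟩ := mul_ne_zero_iff.1 h
    have hik : ∀ k ∈ indexI x, k ≠ i → g i k = g i j ∧ g k i = g i j := by
      intro k hk hki
      rcases eq_or_ne k j with rfl | hkj
      · exact ⟨rfl, hji⟩
      · have := hg.eq_of_coupled hij hki.symm hkj.symm hi hj hk h
        exact ⟨this.2.1, this.2.2.1⟩
    refine ⟨g i j, n₁, fun k hk l hl hkl => ?_⟩
    rcases eq_or_ne k i with rfl | hki
    · exact (hik l hl hkl.symm).1
    rcases eq_or_ne l i with rfl | hli
    · exact (hik k hk hki).2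
    obtain ⟨e₁, e₂⟩ := hik k hk hki
    have := hg.eq_of_coupled hki.symm hli.symm hkl hi hk hl
      (by rw [e₁, e₂]; exact mul_ne_zero n₁ n₁)
    rw [this.2.2.2.1, e₁]
  · right
    push Not at hex
    have hzero : ∀ i ∈ indexI x, ∀ j ∈ indexI x, i < j → g j i = 0 := fun i hi j hj hij =>
      hg.eq_zero_of_uncoupled hij (hex i hi j hj hij.ne)
    have hne : (indexI x).Nonempty := Finset.card_pos.1 (by omega)
    let m := (indexI x).max' hne
    have hm : m ∈ indexI x := Finset.max'_mem _ _
    -- The potential is normalised to vanish at the largest element of `I`.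
    refine ⟨fun i => if i = m then 0 else g i m,
      fun i hi j hj hij => ⟨hzero i hi j hj hij, ?_⟩⟩
    have him : i ≠ m := (hij.trans_le (Finset.le_max' _ j hj)).ne
    rcases eq_or_ne j m with rfl | hjm
    · simp [him]
    · have hlt : j < m := lt_of_le_of_ne (Finset.le_max' _ j hj) hjm
      have := hg.below i j m hij hlt (mem_indexI.1 hj) (mem_indexI.1 hm)
      simp only [him, hjm, if_false, this, skew, hzero j hj m hm hlt]
      ring

end Blocks

/-! ### Comparing presentations -/

section Presentations

variable {N : ℕ}

/-- Two systems of relations that hold for the same families of elements present the same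
algebra. -/
theorem IsPresentedBy.congr {A : Type*} [Ring A] [Algebra ℂ A] {D : Fin N → A}
    {r r' : FreeAlgebra ℂ (Fin N) → FreeAlgebra ℂ (Fin N) → Prop} (h : IsPresentedBy D r)
    (H : ∀ (B : Type) [Ring B] [Algebra ℂ B] (f : FreeAlgebra ℂ (Fin N) →ₐ[ℂ] B),
      (∀ u v, r u v → f u = f v) ↔ ∀ u v, r' u v → f u = f v) :
    IsPresentedBy D r' := by
  obtain ⟨e, he⟩ := h
  have h₁ : ∀ ⦃u v⦄, r u v → RingQuot.mkAlgHom ℂ r' u = RingQuot.mkAlgHom ℂ r' v :=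
    (H _ (RingQuot.mkAlgHom ℂ r')).2 fun u v huv => RingQuot.mkAlgHom_rel ℂ huv
  have h₂ : ∀ ⦃u v⦄, r' u v → RingQuot.mkAlgHom ℂ r u = RingQuot.mkAlgHom ℂ r v :=
    (H _ (RingQuot.mkAlgHom ℂ r)).1 fun u v huv => RingQuot.mkAlgHom_rel ℂ huv
  let E : RingQuot r' ≃ₐ[ℂ] RingQuot r := AlgEquiv.ofAlgHom
    (RingQuot.liftAlgHom ℂ ⟨RingQuot.mkAlgHom ℂ r, h₂⟩)
    (RingQuot.liftAlgHom ℂ ⟨RingQuot.mkAlgHom ℂ r', h₁⟩)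
    (by ext; simp) (by ext; simp)
  refine ⟨E.trans e, fun α => ?_⟩
  rw [← he α]
  simp [E]

section PairRel

variable {B : Type} [Ring B] [Algebra ℂ B] {g : Fin N → Fin N → ℝ} {x : Fin N → ℂ}

/-- The quadratic relation for the pair `α`, `β`, without a condition on their order. -/
def PairRel (E : Fin N → B) (g : Fin N → Fin N → ℝ) (x : Fin N → ℂ) (α β : Fin N) : Prop :=
  (g α β : ℂ) • (E α * E β) - (g β α : ℂ) • (E β * E α) = x β • E α - x α • E β

theorem pairRel_comm {E : Fin N → B} {α β : Fin N} :
    PairRel E g x α β ↔ PairRel E g x β α := by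
  unfold PairRel
  rw [← neg_inj, neg_sub, neg_sub]

theorem pairRel_of_lt {E : Fin N → B} (H : ∀ α β, α < β → PairRel E g x α β) {α β : Fin N}
    (h : α ≠ β) : PairRel E g x α β := by
  rcases lt_or_gt_of_ne h with h | h
  · exact H α β h
  · exact pairRel_comm.1 (H β α h)

variable (f : FreeAlgebra ℂ (Fin N) →ₐ[ℂ] B)

theorem map_quadraticRel_iff :
    (∀ u v, QuadraticRel g x u v → f u = f v) ↔
      ∀ α β, α < β → PairRel (fun α => f (X α)) g x α β := by
  constructor
  · intro H α β h
    simpa [PairRel, -Complex.coe_smul] using H _ _ (QuadraticRel.rel α β h)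
  · rintro H _ _ ⟨α, β, h⟩
    simpa [PairRel, -Complex.coe_smul] using H α β h

/-! For `s ∈ R` the relation of the pair `i`, `s` can be written with either order of the two
products; for an uncoupled pair it has only one quadratic term. -/

theorem map_eq_map_iff_pairRel {i s : Fin N} {p p' : ℝ} (hs : x s = 0) (hp : p = g i s)
    (hp' : p' = g s i) :
    f ((p : ℂ) • (X i * X s) - (p' : ℂ) • (X s * X i)) = f (-(x i • X s)) ↔
      PairRel (fun α => f (X α)) g x i s := by
  simp [PairRel, hp, hp', hs, -Complex.coe_smul]

theorem map_eq_map_iff_pairRel' {i s : Fin N} {p p' : ℝ} (hs : x s = 0) (hp : p = g s i)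
    (hp' : p' = g i s) :
    f ((p : ℂ) • (X s * X i) - (p' : ℂ) • (X i * X s)) = f (x i • X s) ↔
      PairRel (fun α => f (X α)) g x i s := by
  rw [pairRel_comm]
  simp [PairRel, hp, hp', hs, -Complex.coe_smul]

theorem map_mul_eq_iff_pairRel {i t : Fin N} {c : ℝ} (hg : IsConsistent g x) (ht : x t = 0)
    (hit : i < t) (h0 : g i t * g t i = 0) (hc : c = skew g i t) :
    f ((c : ℂ) • (X i * X t)) = f (-(x i • X t)) ↔ PairRel (fun α => f (X α)) g x i t := by
  have := hg.eq_zero_of_uncoupled hit h0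
  simp [PairRel, ht, hc, skew, this, -Complex.coe_smul]

theorem map_mul_eq_iff_pairRel' {i t : Fin N} {c : ℝ} (hg : IsConsistent g x) (ht : x t = 0)
    (hit : t < i) (h0 : g i t * g t i = 0) (hc : c = skew g t i) :
    f ((c : ℂ) • (X t * X i)) = f (x i • X t) ↔ PairRel (fun α => f (X α)) g x i t := by
  have := hg.eq_zero_of_uncoupled hit (by rwa [mul_comm])
  rw [pairRel_comm]
  simp [PairRel, ht, hc, skew, this, -Complex.coe_smul]

theorem map_normalOrd_eq_iff_pairRel {i t : Fin N} {c : ℝ} (hg : IsConsistent g x)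
    (ht : x t = 0) (hit : i ≠ t) (h0 : g i t * g t i = 0) (hc : c = skew g i t) :
    f ((c : ℂ) • normalOrd X i t) = f (-(x i • X t)) ↔
      PairRel (fun α => f (X α)) g x i t := by
  rcases lt_or_gt_of_ne hit with h | h
  · rw [← map_mul_eq_iff_pairRel f hg ht h h0 hc, normalOrd, if_pos h]
  · rw [← map_mul_eq_iff_pairRel' f hg ht h h0 rfl, normalOrd, if_neg h.not_gt, hc, ← neg_skew]
    rw [← neg_inj, ← map_neg, ← map_neg, neg_neg, Complex.ofReal_neg, neg_smul, neg_neg]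

theorem map_relR_iff (hg : IsConsistent g x) {P : Finpartition (indexR x)}
    (hP : ∀ a ∈ P.parts, ∀ b ∈ P.parts, a ≠ b → ∀ r ∈ a, ∀ t ∈ b, g r t * g t r = 0) :
    (∀ u v, RelR (qCoeff g) P.parts u v → f u = f v) ↔
      ∀ r ∈ indexR x, ∀ s ∈ indexR x, r < s → PairRel (fun α => f (X α)) g x r s := by
  have hbetween : ∀ r s, r < s → x r = 0 → x s = 0 → g r s * g s r = 0 →
      (f (X r * X s) = 0 ↔ PairRel (fun α => f (X α)) g x r s) := by
    intro r s hrs hr hs h0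
    have := hg.eq_zero_of_uncoupled hrs h0
    simp [PairRel, hr, hs, this, hg.coeff_ne_zero r s hrs, -Complex.coe_smul]
  have hwithin : ∀ r s, r < s → x r = 0 → x s = 0 →
      (f (X r * X s - (qCoeff g s r : ℂ) • (X s * X r)) = 0 ↔
        PairRel (fun α => f (X α)) g x r s) := by
    intro r s hrs hr hs
    have h0 : (g r s : ℂ) ≠ 0 := by exact_mod_cast hg.coeff_ne_zero r s hrs
    rw [← smul_eq_zero_iff_right h0, ← map_smul, smul_sub, smul_smul, qCoeff,
      Complex.ofReal_div, mul_div_cancel₀ _ h0]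
    simp [PairRel, hr, hs, -Complex.coe_smul]
  constructor
  · intro H r hr s hs hrs
    have hxr := mem_indexR.1 hr
    have hxs := mem_indexR.1 hs
    obtain ⟨a, ha, hra⟩ := P.exists_mem hr
    obtain ⟨b, hb, hsb⟩ := P.exists_mem hs
    rcases eq_or_ne a b with rfl | hab
    · rw [← hwithin r s hrs hxr hxs, ← map_zero f]
      exact H _ _ (RelR.within a ha r s hra hsb hrs)
    · rw [← hbetween r s hrs hxr hxs (hP a ha b hb hab r hra s hsb), ← map_zero f]
      have := H _ _ (RelR.between (q := qCoeff g) a b ha hb hab r s hra hsb)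
      rwa [normalOrd, if_pos hrs] at this
  · rintro H _ _ (⟨a, b, ha, hb, hab, r, s, hr, hs⟩ | ⟨a, ha, r, s, hr, hs, hrs⟩)
    · have hrR := P.le ha hr
      have hsR := P.le hb hs
      have hne : r ≠ s := by
        rintro rfl
        exact Finset.disjoint_left.mp (P.disjoint ha hb hab) hr hs
      rw [map_zero, normalOrd]
      split_ifs with hlt
      · exact (hbetween r s hlt (mem_indexR.1 hrR) (mem_indexR.1 hsR)
          (hP a ha b hb hab r hr s hs)).2 (H r hrR s hsR hlt)
      · have hgt := lt_of_le_of_ne (not_lt.1 hlt) hne.symm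
        exact (hbetween s r hgt (mem_indexR.1 hsR) (mem_indexR.1 hrR)
          (hP b hb a ha hab.symm s hs r hr)).2 (H s hsR r hrR hgt)
    · have hrR := P.le ha hr
      have hsR := P.le ha hs
      rw [map_zero]
      exact (hwithin r s hrs (mem_indexR.1 hrR) (mem_indexR.1 hsR)).2 (H r hrR s hsR hrs)

end PairRel

variable {A : Type*} [Ring A] [Algebra ℂ A] {D : Fin N → A} {g : Fin N → Fin N → ℝ}
  {x : Fin N → ℂ}

/-- To pass to a new presentation it suffices to compare the relations of pairs with at least
one member in `I`; the relations within `R` are the same in all families. -/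
theorem IsDiffusionAlgebra.isPresentedBy_or_relR (h : IsDiffusionAlgebra D g x)
    {P : Finpartition (indexR x)}
    (hP : ∀ a ∈ P.parts, ∀ b ∈ P.parts, a ≠ b → ∀ r ∈ a, ∀ t ∈ b, g r t * g t r = 0)
    {r : FreeAlgebra ℂ (Fin N) → FreeAlgebra ℂ (Fin N) → Prop}
    (hr : ∀ (B : Type) [Ring B] [Algebra ℂ B] (f : FreeAlgebra ℂ (Fin N) →ₐ[ℂ] B),
      (∀ u v, r u v → f u = f v) ↔
        (∀ i ∈ indexI x, ∀ j ∈ indexI x, i < j → PairRel (fun α => f (X α)) g x i j) ∧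
        ∀ i ∈ indexI x, ∀ t ∈ indexR x, PairRel (fun α => f (X α)) g x i t) :
    IsPresentedBy D fun u v => r u v ∨ RelR (qCoeff g) P.parts u v := by
  refine h.presented.congr fun B _ _ f => ?_
  have hsplit : (∀ u v, r u v ∨ RelR (qCoeff g) P.parts u v → f u = f v) ↔
      (∀ u v, r u v → f u = f v) ∧ ∀ u v, RelR (qCoeff g) P.parts u v → f u = f v :=
    ⟨fun H => ⟨fun u v huv => H u v (Or.inl huv), fun u v huv => H u v (Or.inr huv)⟩,
      fun H u v huv => huv.elim (H.1 u v) (H.2 u v)⟩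
  rw [hsplit, map_quadraticRel_iff, hr B f, map_relR_iff f h.isConsistent hP]
  constructor
  · intro H
    exact ⟨⟨fun i _ j _ hij => H i j hij, fun i hi t ht =>
      pairRel_of_lt H (ne_of_mem_indexI_of_mem_indexR hi ht)⟩, fun r _ s _ hrs => H r s hrs⟩
  · rintro ⟨⟨H₁, H₂⟩, H₃⟩ α β hαβ
    by_cases hα : x α = 0 <;> by_cases hβ : x β = 0
    · exact H₃ α (mem_indexR.2 hα) β (mem_indexR.2 hβ) hαβ
    · exact pairRel_comm.1 (H₂ β (mem_indexI.2 hβ) α (mem_indexR.2 hα))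
    · exact H₂ α (mem_indexI.2 hα) β (mem_indexR.2 hβ)
    · exact H₁ α (mem_indexI.2 hα) β (mem_indexI.2 hβ) hαβ

end Presentations

/-! ### The five families -/

section Families

variable {N : ℕ} {A : Type*} [Ring A] [Algebra ℂ A] {D : Fin N → A} {g : Fin N → Fin N → ℝ}
  {x : Fin N → ℂ}

/-- The parameters attached to the blocks `T_a^∘` and `T_b^•`, for coefficients on `I` whose
antisymmetric parts are the differences of a potential `φ`. -/
theorem exists_block_constants (hg : IsConsistent g x) {P : Finpartition (indexR x)}
    (hP : ∀ a ∈ P.parts, IsConnectedBlock g a) {φ : Fin N → ℝ}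
    (hφ : ∀ i ∈ indexI x, ∀ j ∈ indexI x, skew g i j = φ i - φ j) :
    ∃ gc gp gm : Finset (Fin N) → ℝ,
      (∀ a ∈ blocksCirc g P, ∀ t ∈ a, ∀ i ∈ indexI x, skew g i t = φ i + gc a) ∧
      (∀ b ∈ blocksBullet g P, ∀ t ∈ b, ∀ i ∈ indexI x, i < t → skew g i t = φ i + gp b) ∧
      ∀ b ∈ blocksBullet g P, ∀ t ∈ b, ∀ i ∈ indexI x, t < i → skew g t i = gm b - φ i := by
  have hc : ∀ a ∈ blocksCirc g P, ∃ c, ∀ t ∈ a, ∀ i ∈ indexI x, skew g i t = φ i + c :=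
    fun a ha => exists_skew_eq_add_of_not_inGap hg (hP a ha.1) (P.le ha.1)
      (P.nonempty_of_mem_parts ha.1) ha.2.1 ha.2.2 hφ
  have hp : ∀ b ∈ blocksBullet g P, ∃ p m, (∀ t ∈ b, ∀ i ∈ indexI x, i < t →
      skew g i t = φ i + p) ∧ ∀ t ∈ b, ∀ i ∈ indexI x, t < i → skew g t i = m - φ i := by
    intro b hb
    obtain ⟨⟨p, hp⟩, m, hm⟩ := exists_skew_eq_of_inGap hg (hP b hb.1) (P.le hb.1)
      (P.nonempty_of_mem_parts hb.1) hb.2.1 hb.2.2 hφ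
    refine ⟨p, m, hp, fun t ht i hi hti => ?_⟩
    rw [← neg_skew, hm t ht i hi hti, neg_sub]
  choose! gc hgc using hc
  choose! gp gm hgpm using hp
  exact ⟨gc, gp, gm, hgc, fun b hb => (hgpm b hb).1, fun b hb => (hgpm b hb).2⟩

theorem mem_block_cases {P : Finpartition (indexR x)} {r : Fin N} (hr : r ∈ indexR x) :
    r ∈ indexS g P ∨ (∃ a ∈ blocksCirc g P, r ∈ a) ∨ ∃ b ∈ blocksBullet g P, r ∈ b := by
  obtain ⟨a, ha, hra⟩ := P.exists_mem hr
  by_cases hS : IsSBlock g x a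
  · exact Or.inl ⟨a, ha, hra, hS⟩
  by_cases hgap : InGap x a
  · exact Or.inr (Or.inr ⟨a, ⟨ha, hS, hgap⟩, hra⟩)
  · exact Or.inr (Or.inl ⟨a, ⟨ha, hS, hgap⟩, hra⟩)

theorem exists_mem_lt_of_inGap {b : Finset (Fin N)} (hne : b.Nonempty) (h : InGap x b) :
    ∃ i ∈ indexI x, ∃ j ∈ indexI x, ∃ t ∈ b, i < t ∧ t < j := by
  obtain ⟨t, ht⟩ := hne
  obtain ⟨i, hi, j, hj, -, hin, -⟩ := h
  exact ⟨i, hi, j, hj, t, ht, hin t ht⟩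

/-- Here `skew` vanishes on `I`, so the potential is `0` and a coupled block commutes with `I`
up to lower terms. -/
theorem isTypeAI_of_eq_const (h : IsDiffusionAlgebra D g x) {P : Finpartition (indexR x)}
    (hP : ∀ a ∈ P.parts, ∀ b ∈ P.parts, a ≠ b → ∀ r ∈ a, ∀ t ∈ b, g r t * g t r = 0)
    (hconn : ∀ a ∈ P.parts, IsConnectedBlock g a) (h3 : 3 ≤ (indexI x).card) {G : ℝ}
    (hG0 : G ≠ 0) (hG : ∀ i ∈ indexI x, ∀ j ∈ indexI x, i ≠ j → g i j = G) :
    IsTypeAI D x (qCoeff g) P.parts (indexI x) (indexS g P) (blocksCirc g P)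
      (blocksBullet g P) := by
  have hg := h.isConsistent
  have hφ : ∀ i ∈ indexI x, ∀ j ∈ indexI x, skew g i j = (fun _ => (0 : ℝ)) i -
      (fun _ => (0 : ℝ)) j := by
    intro i hi j hj
    rcases eq_or_ne i j with rfl | hij
    · simp [skew_self]
    · simp [skew, hG i hi j hj hij, hG j hj i hi hij.symm]
  obtain ⟨gc, gp, gm, hgc, hgp, hgm⟩ := exists_block_constants hg hconn hφ
  simp only [zero_add, sub_zero] at hgc hgp hgm hφ
  obtain ⟨i₀, hi₀⟩ : (indexI x).Nonempty := Finset.card_pos.1 (by omega)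
  have hS : ∀ s ∈ indexS g P, ∀ i ∈ indexI x, g i s = g i₀ s ∧ g s i = g i₀ s := by
    rintro s ⟨a, ha, hsa, hSa⟩ i hi
    have hsymm : ∀ i ∈ indexI x, g i s = g s i := by
      intro i hi
      obtain ⟨j, hj, hji⟩ := (indexI x).exists_mem_ne (by omega) i
      have := hSa.skew_eq hg (hconn a ha) (P.le ha) hi hj hji.symm hsa
      rw [hφ i hi j hj] at this
      exact sub_eq_zero.1 this
    rcases eq_or_ne i i₀ with rfl | hne
    · exact ⟨rfl, (hsymm i hi).symm⟩
    · have := hSa.coeff_eq hg (hconn a ha) (P.le ha) hi hi₀ hne hsa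
      rw [← hsymm i₀ hi₀] at this
      exact ⟨this, (hsymm i hi).symm.trans this⟩
  refine ⟨h3, G, fun s => g i₀ s, gc, gp, gm, hG0, ?_, ?_, ?_,
    h.isPresentedBy_or_relR hP fun B _ _ f => ?_⟩
  · intro s hs
    have hsR : s ∈ indexR x := by
      obtain ⟨a, ha, hsa, -⟩ := hs
      exact P.le ha hsa
    rcases lt_or_gt_of_ne (ne_of_mem_indexI_of_mem_indexR hi₀ hsR) with hlt | hlt
    · exact hg.coeff_ne_zero _ _ hlt
    · change g i₀ s ≠ 0
      exact (hS s hs i₀ hi₀).2 ▸ hg.coeff_ne_zero _ _ hlt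
  · intro a ha
    obtain ⟨t, ht⟩ := P.nonempty_of_mem_parts ha.1
    rw [← hgc a ha t ht i₀ hi₀]
    exact hg.skew_ne_zero (ne_of_mem_indexI_of_mem_indexR hi₀ (P.le ha.1 ht))
      (uncoupled_of_not_isSBlock ha.2.1 hi₀ ht)
  · intro b hb
    obtain ⟨i, hi, j, hj, t, ht, hit, htj⟩ :=
      exists_mem_lt_of_inGap (P.nonempty_of_mem_parts hb.1) hb.2.2
    rw [← hgp b hb t ht i hi hit, ← hgm b hb t ht j hj htj]
    exact ⟨hg.skew_ne_zero hit.ne (uncoupled_of_not_isSBlock hb.2.1 hi ht),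
      hg.skew_ne_zero htj.ne (by rw [mul_comm]; exact uncoupled_of_not_isSBlock hb.2.1 hj ht)⟩
  · have hII : ∀ i ∈ indexI x, ∀ j ∈ indexI x, i ≠ j →
        (f ((G : ℂ) • (X i * X j - X j * X i)) = f (x j • X i - x i • X j) ↔
          PairRel (fun α => f (X α)) g x i j) := by
      intro i hi j hj hij
      simp [PairRel, hG i hi j hj hij, hG j hj i hi hij.symm, smul_sub, -Complex.coe_smul]
    have hSI : ∀ s ∈ indexS g P, ∀ i ∈ indexI x,
        (f ((g i₀ s : ℂ) • (X s * X i - X i * X s)) = f (x i • X s) ↔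
          PairRel (fun α => f (X α)) g x i s) := by
      rintro s hs i hi
      have hxs : x s = 0 := by
        obtain ⟨a, ha, hsa, -⟩ := hs
        exact mem_indexR.1 (P.le ha hsa)
      rw [smul_sub, map_eq_map_iff_pairRel' f hxs (hS s hs i hi).2.symm (hS s hs i hi).1.symm]
    have hc : ∀ a ∈ blocksCirc g P, ∀ t ∈ a, ∀ i ∈ indexI x,
        (f ((gc a : ℂ) • normalOrd X i t) = f (-(x i • X t)) ↔
          PairRel (fun α => f (X α)) g x i t) := fun a ha t ht i hi =>
      map_normalOrd_eq_iff_pairRel f hg (mem_indexR.1 (P.le ha.1 ht))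
        (ne_of_mem_indexI_of_mem_indexR hi (P.le ha.1 ht))
        (uncoupled_of_not_isSBlock ha.2.1 hi ht) (hgc a ha t ht i hi).symm
    have hp : ∀ b ∈ blocksBullet g P, ∀ t ∈ b, ∀ i ∈ indexI x, i < t →
        (f ((gp b : ℂ) • (X i * X t)) = f (-(x i • X t)) ↔
          PairRel (fun α => f (X α)) g x i t) := fun b hb t ht i hi hit =>
      map_mul_eq_iff_pairRel f hg (mem_indexR.1 (P.le hb.1 ht)) hit
        (uncoupled_of_not_isSBlock hb.2.1 hi ht) (hgp b hb t ht i hi hit).symm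
    have hm : ∀ b ∈ blocksBullet g P, ∀ t ∈ b, ∀ i ∈ indexI x, t < i →
        (f ((gm b : ℂ) • (X t * X i)) = f (x i • X t) ↔
          PairRel (fun α => f (X α)) g x i t) := fun b hb t ht i hi hit =>
      map_mul_eq_iff_pairRel' f hg (mem_indexR.1 (P.le hb.1 ht)) hit
        (uncoupled_of_not_isSBlock hb.2.1 hi ht) (hgm b hb t ht i hi hit).symm
    constructor
    · refine fun H => ⟨fun i hi j hj hij =>
        (hII i hi j hj hij.ne).1 (H _ _ (RelAI.II i j hi hj)), fun i hi t ht => ?_⟩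
      rcases mem_block_cases (g := g) (P := P) ht with hs | ⟨a, ha, hta⟩ | ⟨b, hb, htb⟩
      · exact (hSI t hs i hi).1 (H _ _ (RelAI.SI t i hs hi))
      · exact (hc a ha t hta i hi).1 (H _ _ (RelAI.circ a ha t i hta hi))
      · rcases lt_or_gt_of_ne (ne_of_mem_indexI_of_mem_indexR hi ht) with hlt | hlt
        · exact (hp b hb t htb i hi hlt).1 (H _ _ (RelAI.bulletPlus b hb t i htb hi hlt))
        · exact (hm b hb t htb i hi hlt).1 (H _ _ (RelAI.bulletMinus b hb t i htb hi hlt))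
    · rintro ⟨H₁, H₂⟩ _ _ (⟨i, j, hi, hj⟩ | ⟨s, i, hs, hi⟩ | ⟨a, ha, t, i, ht, hi⟩ |
        ⟨b, hb, t, i, ht, hi, hlt⟩ | ⟨b, hb, t, i, ht, hi, hlt⟩)
      · rcases lt_trichotomy i j with hij | rfl | hij
        · exact (hII i hi j hj hij.ne).2 (H₁ i hi j hj hij)
        · simp
        · exact (hII i hi j hj hij.ne').2 (pairRel_comm.1 (H₁ j hj i hi hij))
      · obtain ⟨a, ha, hsa, -⟩ := id hs
        exact (hSI s hs i hi).2 (H₂ i hi s (P.le ha hsa))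
      · exact (hc a ha t ht i hi).2 (H₂ i hi t (P.le ha.1 ht))
      · exact (hp b hb t ht i hi hlt).2 (H₂ i hi t (P.le hb.1 ht))
      · exact (hm b hb t ht i hi hlt).2 (H₂ i hi t (P.le hb.1 ht))

/-- The potential `φ` provides the parameters `g_i` of the family. -/
theorem isTypeAII_of_eq_sub (h : IsDiffusionAlgebra D g x) {P : Finpartition (indexR x)}
    (hP : ∀ a ∈ P.parts, ∀ b ∈ P.parts, a ≠ b → ∀ r ∈ a, ∀ t ∈ b, g r t * g t r = 0)
    (hconn : ∀ a ∈ P.parts, IsConnectedBlock g a) (h3 : 3 ≤ (indexI x).card) {φ : Fin N → ℝ}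
    (hφ₀ : ∀ i ∈ indexI x, ∀ j ∈ indexI x, i < j → g j i = 0 ∧ g i j = φ i - φ j) :
    IsTypeAII D x (qCoeff g) P.parts (indexI x) (indexS g P) (blocksCirc g P)
      (blocksBullet g P) := by
  have hg := h.isConsistent
  have hφ : ∀ i ∈ indexI x, ∀ j ∈ indexI x, skew g i j = φ i - φ j := by
    intro i hi j hj
    rcases lt_trichotomy i j with hij | rfl | hij
    · simp [skew, hφ₀ i hi j hj hij]
    · simp [skew_self]
    · simp [skew, hφ₀ j hj i hi hij]
  have hne : ∀ i ∈ indexI x, ∀ j ∈ indexI x, i ≠ j → φ i ≠ φ j := by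
    intro i hi j hj hij
    rw [← sub_ne_zero, ← hφ i hi j hj]
    refine hg.skew_ne_zero hij ?_
    rcases lt_or_gt_of_ne hij with hij | hij
    · rw [(hφ₀ i hi j hj hij).1, mul_zero]
    · rw [(hφ₀ j hj i hi hij).1, zero_mul]
  obtain ⟨gc, gp, gm, hgc, hgp, hgm⟩ := exists_block_constants hg hconn hφ
  -- A coupled block would force `φ i - φ j = φ i - φ k` for distinct `i`, `j`, `k` in `I`.
  have hS : indexS g P = ∅ := by
    rw [Set.eq_empty_iff_forall_notMem]
    rintro s ⟨a, ha, hsa, hSa⟩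
    obtain ⟨i, j, k, hi, hj, hk, hij, hik, hjk⟩ := Finset.two_lt_card_iff.1 h3
    have e₁ := hSa.skew_eq hg (hconn a ha) (P.le ha) hi hj hij hsa
    have e₂ := hSa.skew_eq hg (hconn a ha) (P.le ha) hi hk hik hsa
    rw [hφ i hi j hj] at e₁
    rw [hφ i hi k hk] at e₂
    exact hne j hj k hk hjk (by linarith)
  refine ⟨h3, hS, φ, gc, gp, gm, hne, ?_, ?_, h.isPresentedBy_or_relR hP fun B _ _ f => ?_⟩
  · intro a ha i hi
    obtain ⟨t, ht⟩ := P.nonempty_of_mem_parts ha.1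
    rw [Ne, eq_neg_iff_add_eq_zero, ← hgc a ha t ht i hi]
    exact hg.skew_ne_zero (ne_of_mem_indexI_of_mem_indexR hi (P.le ha.1 ht))
      (uncoupled_of_not_isSBlock ha.2.1 hi ht)
  · intro b hb t ht i hi
    have h0 := uncoupled_of_not_isSBlock hb.2.1 hi ht
    refine ⟨fun hlt => ?_, fun hlt => ?_⟩
    · rw [Ne, eq_neg_iff_add_eq_zero, ← hgp b hb t ht i hi hlt]
      exact hg.skew_ne_zero hlt.ne h0
    · rw [ne_comm, ← sub_ne_zero, ← hgm b hb t ht i hi hlt]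
      exact hg.skew_ne_zero hlt.ne (by rwa [mul_comm])
  · have hII : ∀ i ∈ indexI x, ∀ j ∈ indexI x, i < j →
        (f (((φ i - φ j : ℝ) : ℂ) • (X i * X j)) = f (x j • X i - x i • X j) ↔
          PairRel (fun α => f (X α)) g x i j) := by
      intro i hi j hj hij
      rw [← (hφ₀ i hi j hj hij).2]
      simp [PairRel, (hφ₀ i hi j hj hij).1, -Complex.coe_smul]
    have hc : ∀ a ∈ blocksCirc g P, ∀ t ∈ a, ∀ i ∈ indexI x,
        (f (((φ i + gc a : ℝ) : ℂ) • normalOrd X i t) = f (-(x i • X t)) ↔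
          PairRel (fun α => f (X α)) g x i t) := fun a ha t ht i hi =>
      map_normalOrd_eq_iff_pairRel f hg (mem_indexR.1 (P.le ha.1 ht))
        (ne_of_mem_indexI_of_mem_indexR hi (P.le ha.1 ht))
        (uncoupled_of_not_isSBlock ha.2.1 hi ht) (hgc a ha t ht i hi).symm
    have hp : ∀ b ∈ blocksBullet g P, ∀ t ∈ b, ∀ i ∈ indexI x, i < t →
        (f (((φ i + gp b : ℝ) : ℂ) • (X i * X t)) = f (-(x i • X t)) ↔
          PairRel (fun α => f (X α)) g x i t) := fun b hb t ht i hi hit =>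
      map_mul_eq_iff_pairRel f hg (mem_indexR.1 (P.le hb.1 ht)) hit
        (uncoupled_of_not_isSBlock hb.2.1 hi ht) (hgp b hb t ht i hi hit).symm
    have hm : ∀ b ∈ blocksBullet g P, ∀ t ∈ b, ∀ i ∈ indexI x, t < i →
        (f (((gm b - φ i : ℝ) : ℂ) • (X t * X i)) = f (x i • X t) ↔
          PairRel (fun α => f (X α)) g x i t) := fun b hb t ht i hi hit =>
      map_mul_eq_iff_pairRel' f hg (mem_indexR.1 (P.le hb.1 ht)) hit
        (uncoupled_of_not_isSBlock hb.2.1 hi ht) (hgm b hb t ht i hi hit).symm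
    constructor
    · refine fun H => ⟨fun i hi j hj hij =>
        (hII i hi j hj hij).1 (H _ _ (RelAII.II i j hi hj hij)), fun i hi t ht => ?_⟩
      rcases mem_block_cases (g := g) (P := P) ht with hs | ⟨a, ha, hta⟩ | ⟨b, hb, htb⟩
      · simp [hS] at hs
      · exact (hc a ha t hta i hi).1 (H _ _ (RelAII.circ a ha t i hta hi))
      · rcases lt_or_gt_of_ne (ne_of_mem_indexI_of_mem_indexR hi ht) with hlt | hlt
        · exact (hp b hb t htb i hi hlt).1 (H _ _ (RelAII.bulletPlus b hb t i htb hi hlt))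
        · exact (hm b hb t htb i hi hlt).1 (H _ _ (RelAII.bulletMinus b hb t i htb hi hlt))
    · rintro ⟨H₁, H₂⟩ _ _ (⟨i, j, hi, hj, hij⟩ | ⟨a, ha, t, i, ht, hi⟩ |
        ⟨b, hb, t, i, ht, hi, hlt⟩ | ⟨b, hb, t, i, ht, hi, hlt⟩)
      · exact (hII i hi j hj hij).2 (H₁ i hi j hj hij)
      · exact (hc a ha t ht i hi).2 (H₂ i hi t (P.le ha.1 ht))
      · exact (hp b hb t ht i hi hlt).2 (H₂ i hi t (P.le hb.1 ht))
      · exact (hm b hb t ht i hi hlt).2 (H₂ i hi t (P.le hb.1 ht))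

theorem isTypeB_of_card_eq_two (h : IsDiffusionAlgebra D g x) {P : Finpartition (indexR x)}
    (hP : ∀ a ∈ P.parts, ∀ b ∈ P.parts, a ≠ b → ∀ r ∈ a, ∀ t ∈ b, g r t * g t r = 0)
    (hconn : ∀ a ∈ P.parts, IsConnectedBlock g a) (h2 : (indexI x).card = 2) :
    IsTypeB D x (qCoeff g) P.parts (indexI x) (indexS g P) (blocksCirc g P)
      (blocksBullet g P) := by
  have hg := h.isConsistent
  obtain ⟨i, j, hij, hI⟩ : ∃ i j, i < j ∧ indexI x = {i, j} := by
    obtain ⟨i, j, hne, hI⟩ := Finset.card_eq_two.1 h2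
    rcases lt_or_gt_of_ne hne with hlt | hlt
    · exact ⟨i, j, hlt, hI⟩
    · exact ⟨j, i, hlt, by rw [hI, Finset.pair_comm]⟩
  have hi : i ∈ indexI x := by simp [hI]
  have hj : j ∈ indexI x := by simp [hI]
  have hcases : ∀ k ∈ indexI x, k = i ∨ k = j := by simp [hI]
  -- The potential is normalised to vanish at `i`; its value at `j` is then `-Λ`.
  have hφ : ∀ k ∈ indexI x, ∀ l ∈ indexI x, skew g k l =
      (fun k => if k = i then 0 else -skew g i j) k -
        (fun k => if k = i then 0 else -skew g i j) l := by
    intro k hk l hl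
    rcases hcases k hk with rfl | rfl <;> rcases hcases l hl with rfl | rfl <;>
      simp [skew_self, hij.ne', neg_skew]
  obtain ⟨gc, gp, gm, hgc, hgp, hgm⟩ := exists_block_constants hg hconn hφ
  have hci : ∀ a ∈ blocksCirc g P, ∀ t ∈ a, gc a = skew g i t := by
    intro a ha t ht
    simp [hgc a ha t ht i hi]
  have hcj : ∀ a ∈ blocksCirc g P, ∀ t ∈ a, gc a - skew g i j = skew g j t := by
    intro a ha t ht
    simp [hgc a ha t ht j hj, hij.ne']
    ring
  have hgap : ∀ b ∈ blocksBullet g P, ∀ t ∈ b, i < t ∧ t < j := by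
    intro b hb t ht
    obtain ⟨k, hk, l, hl, hkl, hin, -⟩ := hb.2.2
    obtain ⟨h₁, h₂⟩ := hin t ht
    rcases hcases k hk with rfl | rfl <;> rcases hcases l hl with rfl | rfl
    · exact absurd hkl (lt_irrefl _)
    · exact ⟨h₁, h₂⟩
    · exact absurd hkl hij.not_gt
    · exact absurd hkl (lt_irrefl _)
  have hbi : ∀ b ∈ blocksBullet g P, ∀ t ∈ b, gp b = skew g i t := by
    intro b hb t ht
    simp [hgp b hb t ht i hi (hgap b hb t ht).1]
  have hbj : ∀ b ∈ blocksBullet g P, ∀ t ∈ b, gm b + skew g i j = skew g t j := by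
    intro b hb t ht
    simp [hgm b hb t ht j hj (hgap b hb t ht).2, hij.ne']
  have hS : ∀ s ∈ indexS g P, g s i = g i s - skew g i j ∧ g s j = g i s ∧
      g j s = g i s - skew g i j := by
    rintro s ⟨a, ha, hsa, hSa⟩
    have e₁ := hSa.skew_eq hg (hconn a ha) (P.le ha) hi hj hij.ne hsa
    have e₂ := hSa.coeff_eq hg (hconn a ha) (P.le ha) hi hj hij.ne hsa
    have e₃ := hSa.coeff_eq hg (hconn a ha) (P.le ha) hj hi hij.ne' hsa
    have e₄ : g s i = g i s - skew g i j := by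
      rw [← e₁, skew]; ring
    exact ⟨e₄, e₂.symm, e₃.trans e₄⟩
  have hSR : ∀ s ∈ indexS g P, s ∈ indexR x := by
    rintro s ⟨a, ha, hsa, -⟩
    exact P.le ha hsa
  refine ⟨i, j, hij, hI, g i j, skew g i j, fun s => g i s, gc, gp,
    fun b => gm b + skew g i j, hg.coeff_ne_zero i j hij, ?_, ?_, ?_,
    h.isPresentedBy_or_relR hP fun B _ _ f => ?_⟩
  · intro s hs
    obtain ⟨e₁, e₂, e₃⟩ := hS s hs
    refine ⟨?_, ?_⟩
    · rcases lt_or_gt_of_ne (ne_of_mem_indexI_of_mem_indexR hi (hSR s hs)) with hlt | hlt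
      · exact hg.coeff_ne_zero _ _ hlt
      · change g i s ≠ 0
        exact e₂ ▸ hg.coeff_ne_zero _ _ (hlt.trans hij)
    · rintro (hlt | hlt)
      · exact sub_ne_zero.1 (e₁ ▸ hg.coeff_ne_zero _ _ hlt)
      · exact sub_ne_zero.1 (e₃ ▸ hg.coeff_ne_zero _ _ hlt)
  · intro a ha
    obtain ⟨t, ht⟩ := P.nonempty_of_mem_parts ha.1
    rw [← sub_ne_zero (b := skew g i j), hcj a ha t ht, hci a ha t ht]
    exact ⟨hg.skew_ne_zero (ne_of_mem_indexI_of_mem_indexR hi (P.le ha.1 ht))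
        (uncoupled_of_not_isSBlock ha.2.1 hi ht),
      hg.skew_ne_zero (ne_of_mem_indexI_of_mem_indexR hj (P.le ha.1 ht))
        (uncoupled_of_not_isSBlock ha.2.1 hj ht)⟩
  · intro b hb
    obtain ⟨t, ht⟩ := P.nonempty_of_mem_parts hb.1
    obtain ⟨h₁, h₂⟩ := hgap b hb t ht
    change gp b ≠ 0 ∧ gm b + skew g i j ≠ 0
    rw [hbj b hb t ht, hbi b hb t ht]
    exact ⟨hg.skew_ne_zero h₁.ne (uncoupled_of_not_isSBlock hb.2.1 hi ht),
      hg.skew_ne_zero h₂.ne (by rw [mul_comm]; exact uncoupled_of_not_isSBlock hb.2.1 hj ht)⟩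
  · have hIJ : f ((g i j : ℂ) • (X i * X j) - ((g i j - skew g i j : ℝ) : ℂ) • (X j * X i)) =
        f (x j • X i - x i • X j) ↔ PairRel (fun α => f (X α)) g x i j := by
      have : g i j - skew g i j = g j i := by rw [skew]; ring
      rw [this]
      simp [PairRel, -Complex.coe_smul]
    have hSi : ∀ s ∈ indexS g P, (f ((g i s : ℂ) • (X i * X s) -
        ((g i s - skew g i j : ℝ) : ℂ) • (X s * X i)) = f (-(x i • X s)) ↔
          PairRel (fun α => f (X α)) g x i s) := fun s hs =>
      map_eq_map_iff_pairRel f (mem_indexR.1 (hSR s hs)) rfl (hS s hs).1.symm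
    have hSj : ∀ s ∈ indexS g P, (f ((g i s : ℂ) • (X s * X j) -
        ((g i s - skew g i j : ℝ) : ℂ) • (X j * X s)) = f (x j • X s) ↔
          PairRel (fun α => f (X α)) g x j s) := fun s hs =>
      map_eq_map_iff_pairRel' f (mem_indexR.1 (hSR s hs)) (hS s hs).2.1.symm
        (hS s hs).2.2.symm
    have hTi : ∀ a ∈ blocksCirc g P, ∀ t ∈ a,
        (f ((gc a : ℂ) • normalOrd X i t) = f (-(x i • X t)) ↔
          PairRel (fun α => f (X α)) g x i t) := fun a ha t ht =>
      map_normalOrd_eq_iff_pairRel f hg (mem_indexR.1 (P.le ha.1 ht))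
        (ne_of_mem_indexI_of_mem_indexR hi (P.le ha.1 ht))
        (uncoupled_of_not_isSBlock ha.2.1 hi ht) (hci a ha t ht)
    have hTj : ∀ a ∈ blocksCirc g P, ∀ t ∈ a,
        (f (((gc a - skew g i j : ℝ) : ℂ) • normalOrd X j t) = f (-(x j • X t)) ↔
          PairRel (fun α => f (X α)) g x j t) := fun a ha t ht =>
      map_normalOrd_eq_iff_pairRel f hg (mem_indexR.1 (P.le ha.1 ht))
        (ne_of_mem_indexI_of_mem_indexR hj (P.le ha.1 ht))
        (uncoupled_of_not_isSBlock ha.2.1 hj ht) (hcj a ha t ht)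
    have hBi : ∀ b ∈ blocksBullet g P, ∀ t ∈ b,
        (f ((gp b : ℂ) • (X i * X t)) = f (-(x i • X t)) ↔
          PairRel (fun α => f (X α)) g x i t) := fun b hb t ht =>
      map_mul_eq_iff_pairRel f hg (mem_indexR.1 (P.le hb.1 ht)) (hgap b hb t ht).1
        (uncoupled_of_not_isSBlock hb.2.1 hi ht) (hbi b hb t ht)
    have hBj : ∀ b ∈ blocksBullet g P, ∀ t ∈ b,
        (f (((gm b + skew g i j : ℝ) : ℂ) • (X t * X j)) = f (x j • X t) ↔
          PairRel (fun α => f (X α)) g x j t) := fun b hb t ht =>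
      map_mul_eq_iff_pairRel' f hg (mem_indexR.1 (P.le hb.1 ht)) (hgap b hb t ht).2
        (uncoupled_of_not_isSBlock hb.2.1 hj ht) (hbj b hb t ht)
    constructor
    · refine fun H => ⟨fun k hk l hl hkl => ?_, fun k hk t ht => ?_⟩
      · rcases hcases k hk with rfl | rfl <;> rcases hcases l hl with rfl | rfl
        · exact absurd hkl (lt_irrefl _)
        · exact hIJ.1 (H _ _ RelB.ij)
        · exact absurd hkl hij.not_gt
        · exact absurd hkl (lt_irrefl _)
      · rcases mem_block_cases (g := g) (P := P) ht with hs | ⟨a, ha, hta⟩ | ⟨b, hb, htb⟩ <;>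
          rcases hcases k hk with rfl | rfl
        · exact (hSi t hs).1 (H _ _ (RelB.iS t hs))
        · exact (hSj t hs).1 (H _ _ (RelB.Sj t hs))
        · exact (hTi a ha t hta).1 (H _ _ (RelB.iCirc a ha t hta))
        · exact (hTj a ha t hta).1 (H _ _ (RelB.jCirc a ha t hta))
        · exact (hBi b hb t htb).1 (H _ _ (RelB.iBullet b hb t htb))
        · exact (hBj b hb t htb).1 (H _ _ (RelB.bulletj b hb t htb))
    · rintro ⟨H₁, H₂⟩ _ _ (_ | ⟨s, hs⟩ | ⟨s, hs⟩ | ⟨a, ha, t, ht⟩ | ⟨a, ha, t, ht⟩ |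
        ⟨b, hb, t, ht⟩ | ⟨b, hb, t, ht⟩)
      · exact hIJ.2 (H₁ i hi j hj hij)
      · exact (hSi s hs).2 (H₂ i hi s (hSR s hs))
      · exact (hSj s hs).2 (H₂ j hj s (hSR s hs))
      · exact (hTi a ha t ht).2 (H₂ i hi t (P.le ha.1 ht))
      · exact (hTj a ha t ht).2 (H₂ j hj t (P.le ha.1 ht))
      · exact (hBi b hb t ht).2 (H₂ i hi t (P.le hb.1 ht))
      · exact (hBj b hb t ht).2 (H₂ j hj t (P.le hb.1 ht))

/-- The parameter `Λ_a` is the value of `skew g i` on the block `a`. -/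
theorem isTypeC_of_card_eq_one (h : IsDiffusionAlgebra D g x) {P : Finpartition (indexR x)}
    (hP : ∀ a ∈ P.parts, ∀ b ∈ P.parts, a ≠ b → ∀ r ∈ a, ∀ t ∈ b, g r t * g t r = 0)
    (hconn : ∀ a ∈ P.parts, IsConnectedBlock g a) (h1 : (indexI x).card = 1) :
    IsTypeC D x (qCoeff g) P.parts (indexI x) := by
  have hg := h.isConsistent
  obtain ⟨i, hI⟩ := Finset.card_eq_one.1 h1
  have hi : i ∈ indexI x := by simp [hI]
  have hΛ : ∀ a ∈ P.parts, ∃ c, ∀ r ∈ a, g i r - c = g r i := by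
    intro a ha
    obtain ⟨r₀, hr₀⟩ := P.nonempty_of_mem_parts ha
    refine ⟨skew g i r₀, fun r hr => ?_⟩
    rw [hg.skew_eq_of_mem_block (hconn a ha) (P.le ha) hi hr₀ hr, skew]
    ring
  choose! Λ hΛ using hΛ
  refine ⟨i, hI, fun r => g i r, Λ, ?_, h.isPresentedBy_or_relR hP fun B _ _ f => ?_⟩
  · exact fun a ha r hr => ⟨fun hlt => hg.coeff_ne_zero _ _ hlt,
      fun hlt => sub_ne_zero.1 (hΛ a ha r hr ▸ hg.coeff_ne_zero _ _ hlt)⟩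
  · have hiR : ∀ a ∈ P.parts, ∀ r ∈ a, (f ((g i r : ℂ) • (X i * X r) -
        ((g i r - Λ a : ℝ) : ℂ) • (X r * X i)) = f (-(x i • X r)) ↔
          PairRel (fun α => f (X α)) g x i r) := fun a ha r hr =>
      map_eq_map_iff_pairRel f (mem_indexR.1 (P.le ha hr)) rfl (hΛ a ha r hr)
    constructor
    · refine fun H => ⟨fun k hk l hl hkl => ?_, fun k hk t ht => ?_⟩
      · rw [hI, Finset.mem_singleton] at hk hl
        exact absurd hkl (by simp [hk, hl])
      · rw [hI, Finset.mem_singleton] at hk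
        subst hk
        obtain ⟨a, ha, hta⟩ := P.exists_mem ht
        exact (hiR a ha t hta).1 (H _ _ (RelC.iR a ha t hta))
    · rintro ⟨-, H₂⟩ _ _ ⟨a, ha, r, hr⟩
      exact (hiR a ha r hr).2 (H₂ i hi r (P.le ha hr))

theorem isTypeD_of_indexI_eq_empty (h : IsDiffusionAlgebra D g x) {P : Finpartition (indexR x)}
    (hP : ∀ a ∈ P.parts, ∀ b ∈ P.parts, a ≠ b → ∀ r ∈ a, ∀ t ∈ b, g r t * g t r = 0)
    (h0 : indexI x = ∅) :
    IsTypeD D (qCoeff g) P.parts (indexI x) (indexR x) := by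
  refine ⟨h0, h.presented.congr fun B _ _ f => ?_⟩
  have hx : ∀ α, x α = 0 := by
    intro α
    by_contra hα
    simpa [h0] using mem_indexI.2 hα
  have hrel := map_relR_iff f h.isConsistent hP
  rw [map_quadraticRel_iff]
  constructor
  · rintro H _ _ (⟨r, s, hr, hs, hrs⟩ | huv)
    · have hg0 : (g r s : ℂ) ≠ 0 := by exact_mod_cast h.coeff_ne_zero r s hrs
      have := H r s hrs
      simp only [PairRel, hx, zero_smul, sub_self] at this
      rw [map_zero, ← smul_eq_zero_iff_right hg0, ← map_smul, smul_sub, smul_smul, qCoeff,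
        Complex.ofReal_div, mul_div_cancel₀ _ hg0]
      simpa [-Complex.coe_smul] using this
    · exact hrel.2 (fun r _ s _ hrs => H r s hrs) _ _ huv
  · exact fun H r s hrs => hrel.1 (fun u v huv => H u v (Or.inr huv)) r (mem_indexR.2 (hx r)) s
      (mem_indexR.2 (hx s)) hrs

theorem isBlockDecomposition (h : IsDiffusionAlgebra D g x) {P : Finpartition (indexR x)}
    (hP : ∀ a ∈ P.parts, ∀ b ∈ P.parts, a ≠ b → ∀ r ∈ a, ∀ t ∈ b, g r t * g t r = 0)
    (hconn : ∀ a ∈ P.parts, IsConnectedBlock g a) : IsBlockDecomposition D g P := by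
  have hmul : ∀ r s, r < s → r ∈ indexR x → s ∈ indexR x →
      D r * D s = ((g s r : ℂ) / g r s) • (D s * D r) := by
    intro r s hrs hr hs
    simp [h.mul_eq hrs, mem_indexR.1 hr, mem_indexR.1 hs]
  refine ⟨fun a ha b hb hab r hr t ht => ?_, fun a ha r hr t ht hrt => ?_, hconn⟩
  · have hne : r ≠ t := by
      rintro rfl
      exact Finset.disjoint_left.mp (P.disjoint ha hb hab) hr ht
    have h0 := hP a ha b hb hab r hr t ht
    rw [normalOrd]
    split_ifs with hlt
    · simp [hmul r t hlt (P.le ha hr) (P.le hb ht), h.isConsistent.eq_zero_of_uncoupled hlt h0]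
    · have hgt := lt_of_le_of_ne (not_lt.1 hlt) hne.symm
      simp [hmul t r hgt (P.le hb ht) (P.le ha hr),
        h.isConsistent.eq_zero_of_uncoupled hgt (by rwa [mul_comm])]
  · rw [hmul r t hrt (P.le ha hr) (P.le ha ht), qCoeff, Complex.ofReal_div, sub_self]

end Families

end DiffusionAlgebra

theorem mainTheorem1 {N : ℕ} {A : Type*} [Ring A] [Algebra ℂ A] (D : Fin N → A)
    (g : Fin N → Fin N → ℝ) (x : Fin N → ℂ)
    (h : DiffusionAlgebra.IsDiffusionAlgebra D g x) :
    ∃ P : Finpartition (DiffusionAlgebra.indexR x),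
      DiffusionAlgebra.IsBlockDecomposition D g P ∧
      (DiffusionAlgebra.IsTypeAI D x (DiffusionAlgebra.qCoeff g) P.parts
          (DiffusionAlgebra.indexI x) (DiffusionAlgebra.indexS g P)
          (DiffusionAlgebra.blocksCirc g P) (DiffusionAlgebra.blocksBullet g P) ∨
        DiffusionAlgebra.IsTypeAII D x (DiffusionAlgebra.qCoeff g) P.parts
          (DiffusionAlgebra.indexI x) (DiffusionAlgebra.indexS g P)
          (DiffusionAlgebra.blocksCirc g P) (DiffusionAlgebra.blocksBullet g P) ∨
        DiffusionAlgebra.IsTypeB D x (DiffusionAlgebra.qCoeff g) P.parts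
          (DiffusionAlgebra.indexI x) (DiffusionAlgebra.indexS g P)
          (DiffusionAlgebra.blocksCirc g P) (DiffusionAlgebra.blocksBullet g P) ∨
        DiffusionAlgebra.IsTypeC D x (DiffusionAlgebra.qCoeff g) P.parts
          (DiffusionAlgebra.indexI x) ∨
        DiffusionAlgebra.IsTypeD D (DiffusionAlgebra.qCoeff g) P.parts
          (DiffusionAlgebra.indexI x) (DiffusionAlgebra.indexR x)) := by
  obtain ⟨P, hP, hconn⟩ := DiffusionAlgebra.exists_finpartition_isConnectedBlock g
    (DiffusionAlgebra.indexR x)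
  refine ⟨P, DiffusionAlgebra.isBlockDecomposition h hP hconn, ?_⟩
  obtain h0 | h1 | h2 | h3 : (DiffusionAlgebra.indexI x).card = 0 ∨
      (DiffusionAlgebra.indexI x).card = 1 ∨ (DiffusionAlgebra.indexI x).card = 2 ∨
      3 ≤ (DiffusionAlgebra.indexI x).card := by omega
  · exact Or.inr (Or.inr (Or.inr (Or.inr
      (DiffusionAlgebra.isTypeD_of_indexI_eq_empty h hP (Finset.card_eq_zero.1 h0)))))
  · exact Or.inr (Or.inr (Or.inr (Or.inl
      (DiffusionAlgebra.isTypeC_of_card_eq_one h hP hconn h1))))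
  · exact Or.inr (Or.inr (Or.inl (DiffusionAlgebra.isTypeB_of_card_eq_two h hP hconn h2)))
  · rcases h.isConsistent.eq_const_or_eq_sub h3 with ⟨G, hG0, hG⟩ | ⟨φ, hφ⟩
    · exact Or.inl (DiffusionAlgebra.isTypeAI_of_eq_const h hP hconn h3 hG0 hG)
    · exact Or.inr (Or.inl (DiffusionAlgebra.isTypeAII_of_eq_sub h hP hconn h3 hφ))
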